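/- Setting. An o-minimal expansion $\mathcal S$ of the real field comes with its definable sets (with parameters). An FD-filtration on $\mathcal S$ is a family $\Omega=\{\Omega_{\mathcal F,D}\}_{\mathcal F,D\in\mathbb N}$ of collections of definable sets such that $\Omega_{\mathcal F,D}\subset\Omega_{\mathcal F+1,D}\cap\Omega_{\mathcal F,D+1}$ for all $\mathcal F,D$ and every definable set lies in some $\Omega_{\mathcal F,D}$; if $X\in\Omega_{\mathcal F,D}$ we say that $X$ has format $\mathcal F$ and degree $D$. The pair $(\mathcal S,\Omega)$ is presharp if for every $\mathcal F$ there is a polynomial $P_{\mathcal F}\in\mathbb N[t]$ such that the following hold. (P1)–(P3): for every $A\in\Omega_{\mathcal F,D}$: if $A\subset\mathbb R$, then $A$ has at most $P_{\mathcal F}(D)$ connected components; if $A\subset\mathbb R^\ell$, then $\mathcal F\ge\ell$, the sets $A^c$, $A\times\mathbb R$, $\mathbb R\times A$ are in $\Omega_{\mathcal F+1,D}$, and so is (for $\ell\geq1$) the projection of $A$ to the first $\ell-1$ coordinates. (P4)–(P5): if $A_1,A_2\subset\mathbb R^\ell$ with $A_i\in\Omega_{\mathcal F_i,D_i}$, then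 $A_1\cup A_2$ and $A_1\cap A_2$ are in $\Omega_{\max\{\mathcal F_1,\mathcal F_2\}+1,\,D_1+D_2}$. (P6): $\{P=0\}\in\Omega_{\ell,\deg P}$ for every $P\in\mathbb R[x_1,\dots,x_\ell]$ (with $\deg 0=0$). Proposition. Let $(\mathcal S,\Omega)$ be a presharp structure. There exist a function $C:\mathbb N^2\to\mathbb N$ and, for each $\mathcal F\in\mathbb N$, a polynomial $Q_{\mathcal F}\in\mathbb N[x,y]$, all depending only on $(\mathcal S,\Omega)$, such that the following holds for every integer $r\ge1$ and all $\mathcal F,D,\ell\in\mathbb N$. Let $X\subset\mathbb R^\ell$ be a set of format $\mathcal F$ and degree $D$. Then $X$ is a disjoint union $$X=\bigsqcup_{0\le i\le\dim X}X_i$$ of $\dim X+1$ (possibly empty) pieces, where each $X_i$ is a (possibly disconnected) embedded $C^r$ submanifold of $\mathbb R^\ell$, of some constant dimension, and $X_i\in\Omega_{C(\mathcal F,r),\,Q_{\mathcal F}(D,r)}$. Here $\dim$ is the o-minimal dimension, i.e. the largest $d$ such that the projection of $X$ to some $d$ of the coordinates has nonempty interior in $\mathbb R^d$, with $\dim\emptyset=-\infty$,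 so that for $X=\emptyset$ the union is empty. -/

import Mathlib

open Set

noncomputable section

namespace SharplyOMinimal

/-- `A × ℝ ⊆ ℝⁿ⁺¹` for `A ⊆ ℝⁿ`. -/
def prodLine {n : ℕ} (A : Set (Fin n → ℝ)) : Set (Fin (n + 1) → ℝ) :=
  {x | (fun i : Fin n => x i.castSucc) ∈ A}

/-- `ℝ × A ⊆ ℝⁿ⁺¹` for `A ⊆ ℝⁿ`. -/
def lineProd {n : ℕ} (A : Set (Fin n → ℝ)) : Set (Fin (n + 1) → ℝ) :=
  {x | (fun i : Fin n => x i.succ) ∈ A}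

/-- The image of `A ⊆ ℝⁿ⁺¹` under the projection to the first `n` coordinates. -/
def projInit {n : ℕ} (A : Set (Fin (n + 1) → ℝ)) : Set (Fin n → ℝ) :=
  (fun (x : Fin (n + 1) → ℝ) (i : Fin n) => x i.castSucc) '' A

/-- Finite unions of intervals of `ℝ` (points, bounded and unbounded intervals): the intervals
are the order-connected subsets of `ℝ`. -/
def IsFiniteUnionOfIntervals (A : Set ℝ) : Prop :=
  ∃ I : Set (Set ℝ), I.Finite ∧ (∀ J ∈ I, J.OrdConnected) ∧ A = ⋃₀ I

/-- An o-minimal expansion of the real field, given by its definable sets (with parameters):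
`Def n` is the collection of the definable subsets of `ℝⁿ`. -/
structure OMinimalExpansion where
  Def : (n : ℕ) → Set (Set (Fin n → ℝ))
  empty_mem : ∀ n, ∅ ∈ Def n
  union_mem : ∀ {n} {A B : Set (Fin n → ℝ)}, A ∈ Def n → B ∈ Def n → A ∪ B ∈ Def n
  compl_mem : ∀ {n} {A : Set (Fin n → ℝ)}, A ∈ Def n → Aᶜ ∈ Def n
  prodLine_mem : ∀ {n} {A : Set (Fin n → ℝ)}, A ∈ Def n → prodLine A ∈ Def (n + 1)
  lineProd_mem : ∀ {n} {A : Set (Fin n → ℝ)}, A ∈ Def n → lineProd A ∈ Def (n + 1)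
  diagonal_mem : ∀ n (i j : Fin n), {x : Fin n → ℝ | x i = x j} ∈ Def n
  proj_mem : ∀ {n} {A : Set (Fin (n + 1) → ℝ)}, A ∈ Def (n + 1) → projInit A ∈ Def n
  lt_mem : {x : Fin 2 → ℝ | x 0 < x 1} ∈ Def 2
  add_mem : {x : Fin 3 → ℝ | x 0 + x 1 = x 2} ∈ Def 3
  mul_mem : {x : Fin 3 → ℝ | x 0 * x 1 = x 2} ∈ Def 3
  mem_one_iff : ∀ A : Set ℝ,
    {x : Fin 1 → ℝ | x 0 ∈ A} ∈ Def 1 ↔ IsFiniteUnionOfIntervals A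

/-- An FD-filtration on `S`: `X ∈ Ω.sets F D ℓ` says that `X ⊆ ℝ^ℓ` has format `F` and
degree `D`. -/
structure FDFiltration (S : OMinimalExpansion) where
  sets : (F D : ℕ) → (ℓ : ℕ) → Set (Set (Fin ℓ → ℝ))
  definable : ∀ F D ℓ, sets F D ℓ ⊆ S.Def ℓ
  mono : ∀ F D ℓ, sets F D ℓ ⊆ sets (F + 1) D ℓ ∩ sets F (D + 1) ℓ
  exhaustive : ∀ ℓ, ∀ X ∈ S.Def ℓ, ∃ F D, X ∈ sets F D ℓ

/-- The axioms of a presharp o-minimal structure. -/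
structure IsPresharp {S : OMinimalExpansion} (Ω : FDFiltration S) : Prop where
  components : ∀ F : ℕ, ∃ P : Polynomial ℕ, ∀ (D : ℕ), ∀ A ∈ Ω.sets F D 1,
    ENat.card (ConnectedComponents A) ≤ (P.eval D : ℕ)
  dim_le_format : ∀ F D ℓ, ∀ A ∈ Ω.sets F D ℓ, ℓ ≤ F
  proj : ∀ F D ℓ, ∀ A ∈ Ω.sets F D (ℓ + 1), projInit A ∈ Ω.sets (F + 1) D ℓ
  compl : ∀ F D ℓ, ∀ A ∈ Ω.sets F D ℓ, Aᶜ ∈ Ω.sets (F + 1) D ℓ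
  prodLine : ∀ F D ℓ, ∀ A ∈ Ω.sets F D ℓ, prodLine A ∈ Ω.sets (F + 1) D (ℓ + 1)
  lineProd : ∀ F D ℓ, ∀ A ∈ Ω.sets F D ℓ, lineProd A ∈ Ω.sets (F + 1) D (ℓ + 1)
  union : ∀ F₁ F₂ D₁ D₂ ℓ, ∀ A₁ ∈ Ω.sets F₁ D₁ ℓ, ∀ A₂ ∈ Ω.sets F₂ D₂ ℓ,
    A₁ ∪ A₂ ∈ Ω.sets (max F₁ F₂ + 1) (D₁ + D₂) ℓ
  inter : ∀ F₁ F₂ D₁ D₂ ℓ, ∀ A₁ ∈ Ω.sets F₁ D₁ ℓ, ∀ A₂ ∈ Ω.sets F₂ D₂ ℓ,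
    A₁ ∩ A₂ ∈ Ω.sets (max F₁ F₂ + 1) (D₁ + D₂) ℓ
  zeros : ∀ ℓ (P : MvPolynomial (Fin ℓ) ℝ),
    {x : Fin ℓ → ℝ | MvPolynomial.eval x P = 0} ∈ Ω.sets ℓ P.totalDegree ℓ

open Classical in
/-- The o-minimal dimension of a definable set `X ⊆ ℝ^ℓ`: the largest `d` such that the image
of `X` under the projection to some `d` of the coordinates has nonempty interior in `ℝ^d`
(`⊥` for the empty set). -/
def omDim {ℓ : ℕ} (X : Set (Fin ℓ → ℝ)) : WithBot ℕ :=
  (Finset.univ.filter fun s : Finset (Fin ℓ) =>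
    (interior ((fun (x : Fin ℓ → ℝ) (i : s) => x i) '' X)).Nonempty).sup
      fun s => (s.card : WithBot ℕ)

/-- `Y ⊆ ℝ^ℓ` is an embedded `C^r` submanifold of dimension `k`: near each of its points a `C^r`
diffeomorphism between open subsets of `ℝ^ℓ` straightens `Y` to `ℝ^k × {0}`. -/
def IsEmbeddedSubmanifold {ℓ : ℕ} (r k : ℕ) (Y : Set (Fin ℓ → ℝ)) : Prop :=
  k ≤ ℓ ∧ ∀ p ∈ Y, ∃ φ : OpenPartialHomeomorph (Fin ℓ → ℝ) (Fin ℓ → ℝ),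
    p ∈ φ.source ∧ ContDiffOn ℝ r φ φ.source ∧ ContDiffOn ℝ r φ.symm φ.target ∧
      φ '' (φ.source ∩ Y) = φ.target ∩ {y | ∀ i : Fin ℓ, k ≤ (i : ℕ) → y i = 0}

end SharplyOMinimal

end

/-!
The degree of a set built from others by Boolean operations, projections and polynomial conditions
is governed by the axioms in a way that does not involve the format: unions and intersections add
degrees, complements, projections and products with a line keep them, and a polynomial condition
costs its degree, however many variables it has. So a first-order formula in which `X` and
polynomial conditions occur a bounded number of times defines a set of degree linear in `D` and in
the degrees of the polynomials, while its format depends on the number of quantified variables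
(`Sharp` and its closure properties). It suffices to describe the strata by such formulas, with
polynomials of degree linear in `r`.

A point of `X` is regular in dimension `d` if near it `X` is the graph over some `d` coordinates of
a map with uniform Taylor expansions of order `r + 1` (`IsRegularPt`). The number of coefficients of
the expansion grows with `r`, but they only add variables, and the condition on them is one
inequality of degree linear in `r`. By the converse of Taylor's theorem (`TaylorOn.contDiffAt`) the
map is `C^r`, so the set of regular points of dimension `d` is an embedded submanifold. Removing the
regular points of dimensions `ℓ, ℓ - 1, …, 0` one after the other exhausts `X`, because the removal
of the regular points of dimension `d` from a set of dimension at most `d` leaves a set of dimension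
less than `d` (`exists_isRegularPt`).

This last fact is o-minimal geometry, and over the reals it follows from Baire's theorem. A
definable set is, on some open subset of any given open set, everything or nothing
(`IsDef.genericallyConstant`), so if countably many definable sets cover an open set, then one of
them has interior points (`IsDef.exists_open_of_cover`). Covers by conditions with rational
parameters give the rest. A definable function is monotone in any given coordinate direction on some
open set, hence differentiable in that direction at some point by Lebesgue's theorem
(`IsDefFun.exists_differentiableAt`), hence on some open set; iterating this for the partial
derivatives, and integrating, one obtains uniform Taylor expansions of any order on some open set
(`IsDefFun.exists_open_taylorOn`). And where a set of dimension `d` projects onto an open subset of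
`ℝ^d`, generic fibres are finite, so over some open subset it has just one point in a fixed box, and
these points form the graph of a definable map.
-/

namespace SharplyOMinimal

/-! ### Formulas and their complexity -/

variable {S : OMinimalExpansion} {Ω : FDFiltration S}

theorem FDFiltration.sets_mono (Ω : FDFiltration S) {F F' D D' ℓ : ℕ} (hF : F ≤ F') (hD : D ≤ D') :
    Ω.sets F D ℓ ⊆ Ω.sets F' D' ℓ := by
  have h1 : Ω.sets F D ℓ ⊆ Ω.sets F' D ℓ := by
    induction hF with
    | refl => exact subset_rfl
    | step _ ih => exact ih.trans fun A hA => (Ω.mono _ _ _ hA).1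
  have h2 : Ω.sets F' D ℓ ⊆ Ω.sets F' D' ℓ := by
    induction hD with
    | refl => exact subset_rfl
    | step _ ih => exact ih.trans fun A hA => (Ω.mono _ _ _ hA).2
  exact h1.trans h2

theorem IsPresharp.preimage_natAdd_mem (hΩ : IsPresharp Ω) {F D m : ℕ} {A : Set (Fin m → ℝ)}
    (hA : A ∈ Ω.sets F D m) (n : ℕ) :
    {z : Fin (n + m) → ℝ | (fun i => z (Fin.natAdd n i)) ∈ A} ∈ Ω.sets (F + n) D (n + m) := by
  have key : ∀ (n k : ℕ) (hk : n + m = k),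
      {z : Fin k → ℝ | (fun i => z (Fin.cast hk (Fin.natAdd n i))) ∈ A} ∈ Ω.sets (F + n) D k := by
    intro n
    induction n with
    | zero =>
      intro k hk
      obtain rfl : m = k := by omega
      have e : {z : Fin m → ℝ | (fun i => z (Fin.cast hk (Fin.natAdd 0 i))) ∈ A} = A := by
        ext z
        simp
      rw [e]
      exact hA
    | succ n ih =>
      intro k hk
      obtain ⟨k, rfl⟩ : ∃ k', k = k' + 1 := ⟨n + m, by omega⟩
      have h := hΩ.lineProd _ _ _ _ (ih k (by omega))
      have e : ∀ i : Fin m, Fin.cast hk (Fin.natAdd (n + 1) i)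
          = (Fin.cast (by omega : n + m = k) (Fin.natAdd n i)).succ := by
        intro i; ext; simp; omega
      simp only [e]
      exact h
  simpa using key n (n + m) rfl

theorem IsPresharp.proj_castAdd_mem (hΩ : IsPresharp Ω) {F D n : ℕ} (m : ℕ)
    {A : Set (Fin (n + m) → ℝ)} (hA : A ∈ Ω.sets F D (n + m)) :
    {x : Fin n → ℝ | ∃ z ∈ A, ∀ i, z (Fin.castAdd m i) = x i} ∈ Ω.sets (F + m) D n := by
  induction m generalizing F with
  | zero =>
    have e : {x : Fin n → ℝ | ∃ z ∈ A, ∀ i, z (Fin.castAdd 0 i) = x i} = A := by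
      ext x
      constructor
      · rintro ⟨z, hz, h⟩
        obtain rfl : z = x := funext h
        exact hz
      · intro h
        exact ⟨x, h, fun i => rfl⟩
    rw [e]
    exact hA
  | succ m ih =>
    have h := ih (hΩ.proj _ _ _ _ hA)
    rw [show F + (m + 1) = F + 1 + m by omega]
    convert h using 1
    ext x
    constructor
    · rintro ⟨z, hz, h⟩
      exact ⟨_, ⟨z, hz, rfl⟩, fun i => h i⟩
    · rintro ⟨_, ⟨z, hz, rfl⟩, h⟩
      exact ⟨z, hz, fun i => h i⟩

/-- Renaming variables is a projection of an intersection with one quadric, so it raises the degree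
by `2` whatever the number of variables. -/
theorem IsPresharp.reindex_mem (hΩ : IsPresharp Ω) {F D m n : ℕ} {A : Set (Fin m → ℝ)}
    (hA : A ∈ Ω.sets F D m) (σ : Fin m → Fin n) :
    {x : Fin n → ℝ | (fun i => x (σ i)) ∈ A} ∈ Ω.sets (3 * F + n + 1) (D + 2) n := by
  have hmF := hΩ.dim_le_format _ _ _ _ hA
  let Q : MvPolynomial (Fin (n + m)) ℝ :=
    ∑ i, (MvPolynomial.X (Fin.natAdd n i) - MvPolynomial.X (Fin.castAdd m (σ i))) ^ 2
  have hQ : Q.totalDegree ≤ 2 := by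
    refine MvPolynomial.totalDegree_finsetSum_le fun i _ => ?_
    refine (MvPolynomial.totalDegree_pow _ _).trans ?_
    have := MvPolynomial.totalDegree_sub (MvPolynomial.X (R := ℝ) (Fin.natAdd n i))
      (MvPolynomial.X (Fin.castAdd m (σ i)))
    simp only [MvPolynomial.totalDegree_X, max_self] at this
    omega
  have h1 := hΩ.inter _ _ _ _ _ _ (hΩ.preimage_natAdd_mem hA n) _ (hΩ.zeros _ Q)
  have h2 := Ω.sets_mono (F' := 2 * F + n + 1) (D' := D + 2)
    (by rcases max_cases (F + n) (n + m) with h | h <;> omega) (by omega) h1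
  have h3 := Ω.sets_mono (F' := 3 * F + n + 1) (by omega) le_rfl (hΩ.proj_castAdd_mem m h2)
  convert h3 using 1
  ext x
  constructor
  · intro hx
    refine ⟨Fin.append x (fun i => x (σ i)), ⟨?_, ?_⟩, fun i => by simp⟩
    · simpa using hx
    · simp [Q]
  · rintro ⟨z, ⟨hz, hzQ⟩, hx⟩
    have h0 : ∀ i, z (Fin.natAdd n i) = x (σ i) := by
      intro i
      simp only [Q, mem_ofPred_eq, map_sum, map_pow, map_sub, MvPolynomial.eval_X] at hzQ
      have := (Finset.sum_eq_zero_iff_of_nonneg (fun i _ => sq_nonneg _)).1 hzQ i (Finset.mem_univ _)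
      rw [← hx]
      nlinarith [pow_eq_zero_iff (two_ne_zero) |>.1 this]
    simpa [h0] using hz

/-- The three numbers that the complexity of a member of a family may depend on: a format, a degree
and an order of smoothness. -/
structure Scale (P : Type) where
  F : P → ℕ
  D : P → ℕ
  r : P → ℕ

variable {P : Type} {sc : Scale P}

/-- The value at `p` of a bound that is polynomial in the degree and the order of smoothness. -/
noncomputable def Scale.val (sc : Scale P) (q : MvPolynomial (Fin 2) ℕ) (p : P) : ℕ :=
  MvPolynomial.eval ![sc.D p, sc.r p] q

/-- The number of variables is bounded in terms of the format and the order of smoothness. -/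
def BddVars (sc : Scale P) (ι : P → Type) [∀ p, Fintype (ι p)] : Prop :=
  ∃ b : ℕ → ℕ → ℕ, ∀ p, Fintype.card (ι p) ≤ b (sc.F p) (sc.r p)

/-- A family of conditions on real variables indexed by `ι p` that cuts out sets of format bounded
in terms of `F` and `r`, and of degree polynomial in `D` and `r` alone. The variables are numbered
by `Fintype.equivFin`. -/
def Sharp (Ω : FDFiltration S) (sc : Scale P) {ι : P → Type} [∀ p, Fintype (ι p)]
    (A : ∀ p, (ι p → ℝ) → Prop) : Prop :=
  ∃ (c : ℕ → ℕ → ℕ) (q : MvPolynomial (Fin 2) ℕ), ∀ p,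
    {x : Fin (Fintype.card (ι p)) → ℝ | A p fun i => x (Fintype.equivFin (ι p) i)} ∈
      Ω.sets (c (sc.F p) (sc.r p)) (sc.val q p) (Fintype.card (ι p))

variable {ι κ : P → Type} [∀ p, Fintype (ι p)] [∀ p, Fintype (κ p)]
  {A B : ∀ p, (ι p → ℝ) → Prop}

theorem BddVars.const (k : Type) [Fintype k] : BddVars sc (fun _ => k) :=
  ⟨fun _ _ => Fintype.card k, fun _ => le_rfl⟩

theorem BddVars.sum (h : BddVars sc ι) (h' : BddVars sc κ) : BddVars sc (fun p => ι p ⊕ κ p) := by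
  obtain ⟨b, hb⟩ := h
  obtain ⟨b', hb'⟩ := h'
  refine ⟨fun x y => b x y + b' x y, fun p => ?_⟩
  have := hb p
  have := hb' p
  simp only [Fintype.card_sum]
  omega

theorem Sharp.congr (hA : Sharp Ω sc A) (h : ∀ p x, B p x ↔ A p x) : Sharp Ω sc B := by
  have : B = A := by funext p x; exact propext (h p x)
  rwa [this]

theorem Sharp.not (hΩ : IsPresharp Ω) (hA : Sharp Ω sc A) : Sharp Ω sc fun p x => ¬ A p x := by
  obtain ⟨c, q, h⟩ := hA
  exact ⟨fun x y => c x y + 1, q, fun p => hΩ.compl _ _ _ _ (h p)⟩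

theorem Sharp.and (hΩ : IsPresharp Ω) (hA : Sharp Ω sc A) (hB : Sharp Ω sc B) :
    Sharp Ω sc fun p x => A p x ∧ B p x := by
  obtain ⟨c, q, h⟩ := hA
  obtain ⟨c', q', h'⟩ := hB
  refine ⟨fun x y => max (c x y) (c' x y) + 1, q + q', fun p => ?_⟩
  rw [show sc.val (q + q') p = sc.val q p + sc.val q' p by simp [Scale.val]]
  exact hΩ.inter _ _ _ _ _ _ (h p) _ (h' p)

theorem Sharp.or (hΩ : IsPresharp Ω) (hA : Sharp Ω sc A) (hB : Sharp Ω sc B) :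
    Sharp Ω sc fun p x => A p x ∨ B p x := by
  obtain ⟨c, q, h⟩ := hA
  obtain ⟨c', q', h'⟩ := hB
  refine ⟨fun x y => max (c x y) (c' x y) + 1, q + q', fun p => ?_⟩
  rw [show sc.val (q + q') p = sc.val q p + sc.val q' p by simp [Scale.val]]
  exact hΩ.union _ _ _ _ _ _ (h p) _ (h' p)

theorem Sharp.imp (hΩ : IsPresharp Ω) (hA : Sharp Ω sc A) (hB : Sharp Ω sc B) :
    Sharp Ω sc fun p x => A p x → B p x :=
  ((hA.not hΩ).or hΩ hB).congr fun _ _ => imp_iff_not_or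

theorem Sharp.subst (hΩ : IsPresharp Ω) (hA : Sharp Ω sc A) (hκ : BddVars sc κ)
    (σ : ∀ p, ι p → κ p) : Sharp Ω sc fun p (z : κ p → ℝ) => A p fun i => z (σ p i) := by
  obtain ⟨c, q, h⟩ := hA
  obtain ⟨b, hb⟩ := hκ
  refine ⟨fun x y => 3 * c x y + b x y + 1, q + MvPolynomial.C 2, fun p => ?_⟩
  have h1 := hΩ.reindex_mem (h p)
    (fun i => Fintype.equivFin (κ p) (σ p ((Fintype.equivFin (ι p)).symm i)))
  have h2 := Ω.sets_mono (F' := 3 * c (sc.F p) (sc.r p) + b (sc.F p) (sc.r p) + 1)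
    (by have := hb p; omega) le_rfl h1
  simpa [Scale.val] using h2

theorem Sharp.mem_sets_fin (hΩ : IsPresharp Ω) {ℓ : ℕ} {A : ∀ _ : P, (Fin ℓ → ℝ) → Prop}
    (hA : Sharp Ω sc A) : ∃ (c : ℕ → ℕ → ℕ) (q : MvPolynomial (Fin 2) ℕ), ∀ p,
      {x | A p x} ∈ Ω.sets (c (sc.F p) (sc.r p)) (sc.val q p) ℓ := by
  obtain ⟨c, q, h⟩ := hA
  refine ⟨fun x y => 3 * c x y + ℓ + 1, q + MvPolynomial.C 2, fun p => ?_⟩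
  have h1 := hΩ.reindex_mem (h p) (fun i => (Fintype.equivFin (Fin ℓ)).symm i)
  simpa [Scale.val] using h1

theorem Sharp.of_mem_sets_fin (hΩ : IsPresharp Ω) {ℓ : ℕ} {A : ∀ _ : P, (Fin ℓ → ℝ) → Prop}
    {c : ℕ → ℕ → ℕ} {q : MvPolynomial (Fin 2) ℕ}
    (h : ∀ p, {x | A p x} ∈ Ω.sets (c (sc.F p) (sc.r p)) (sc.val q p) ℓ) : Sharp Ω sc A := by
  refine ⟨fun x y => 3 * c x y + Fintype.card (Fin ℓ) + 1, q + MvPolynomial.C 2, fun p => ?_⟩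
  simpa [Scale.val] using hΩ.reindex_mem (h p) (fun i => Fintype.equivFin (Fin ℓ) i)

theorem Sharp.ex (hΩ : IsPresharp Ω) {A : ∀ p, (ι p → ℝ) → (κ p → ℝ) → Prop}
    (hA : Sharp Ω sc fun p (z : ι p ⊕ κ p → ℝ) =>
      A p (fun i => z (Sum.inl i)) (fun j => z (Sum.inr j))) :
    Sharp Ω sc fun p (x : ι p → ℝ) => ∃ t, A p x t := by
  obtain ⟨c, q, h⟩ := hA
  refine ⟨fun x y => (3 * c x y + c x y + 1) + c x y, q + MvPolynomial.C 2, fun p => ?_⟩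
  have hn := hΩ.dim_le_format _ _ _ _ (h p)
  simp only [Fintype.card_sum] at hn
  let e : Fin (Fintype.card (ι p) + Fintype.card (κ p)) ≃ ι p ⊕ κ p :=
    finSumFinEquiv.symm.trans
      (Equiv.sumCongr (Fintype.equivFin (ι p)).symm (Fintype.equivFin (κ p)).symm)
  have h1 := hΩ.reindex_mem (h p) (fun i => e.symm ((Fintype.equivFin (ι p ⊕ κ p)).symm i))
  have h2 := Ω.sets_mono (F' := 3 * c (sc.F p) (sc.r p) + c (sc.F p) (sc.r p) + 1)
    (by omega) le_rfl h1
  have h3 := hΩ.proj_castAdd_mem (Fintype.card (κ p)) h2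
  have h4 := Ω.sets_mono
    (F' := 3 * c (sc.F p) (sc.r p) + c (sc.F p) (sc.r p) + 1 + c (sc.F p) (sc.r p))
    (by omega) le_rfl h3
  simp only [mem_ofPred_eq, Equiv.symm_apply_apply, Scale.val, map_add, MvPolynomial.eval_C] at h4 ⊢
  convert h4 using 1
  ext x
  simp only [mem_ofPred_eq, e, Equiv.symm_trans_apply, Equiv.symm_symm, Equiv.sumCongr_symm,
    Equiv.sumCongr_apply, Sum.map_inl, Sum.map_inr, finSumFinEquiv_apply_left,
    finSumFinEquiv_apply_right]
  constructor
  · rintro ⟨t, ht⟩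
    refine ⟨Fin.append x (fun j => t ((Fintype.equivFin (κ p)).symm j)), ?_, fun i => by simp⟩
    simpa using ht
  · rintro ⟨z, hz, hx⟩
    exact ⟨_, by simpa [hx] using hz⟩

theorem Sharp.all (hΩ : IsPresharp Ω) {A : ∀ p, (ι p → ℝ) → (κ p → ℝ) → Prop}
    (hA : Sharp Ω sc fun p (z : ι p ⊕ κ p → ℝ) =>
      A p (fun i => z (Sum.inl i)) (fun j => z (Sum.inr j))) :
    Sharp Ω sc fun p (x : ι p → ℝ) => ∀ t, A p x t :=
  ((Sharp.ex (A := fun p x t => ¬ A p x t) hΩ (hA.not hΩ)).not hΩ).congr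
    fun p x => by simp

theorem Sharp.ex_real (hΩ : IsPresharp Ω) {A : ∀ p, (ι p → ℝ) → ℝ → Prop}
    (hA : Sharp Ω sc fun p (z : ι p ⊕ Unit → ℝ) => A p (fun i => z (Sum.inl i)) (z (Sum.inr ()))) :
    Sharp Ω sc fun p (x : ι p → ℝ) => ∃ t, A p x t :=
  (Sharp.ex (κ := fun _ => Unit) (A := fun p x t => A p x (t ())) hΩ hA).congr fun _ _ =>
    ⟨fun ⟨t, ht⟩ => ⟨fun _ => t, ht⟩, fun ⟨t, ht⟩ => ⟨t (), ht⟩⟩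

theorem Sharp.all_real (hΩ : IsPresharp Ω) {A : ∀ p, (ι p → ℝ) → ℝ → Prop}
    (hA : Sharp Ω sc fun p (z : ι p ⊕ Unit → ℝ) => A p (fun i => z (Sum.inl i)) (z (Sum.inr ()))) :
    Sharp Ω sc fun p (x : ι p → ℝ) => ∀ t, A p x t :=
  (Sharp.all (κ := fun _ => Unit) (A := fun p x t => A p x (t ())) hΩ hA).congr fun _ _ =>
    ⟨fun h t => h (t ()), fun h t => h fun _ => t⟩

/-- `f` is a polynomial function of degree at most `n`. -/
def IsPolyOfDegreeLE {ι : Type} (n : ℕ) (f : (ι → ℝ) → ℝ) : Prop :=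
  ∃ Q : MvPolynomial ι ℝ, Q.totalDegree ≤ n ∧ ∀ x, f x = MvPolynomial.eval x Q

namespace IsPolyOfDegreeLE

variable {ι : Type} {m n : ℕ} {f g : (ι → ℝ) → ℝ}

theorem mono (hf : IsPolyOfDegreeLE m f) (h : m ≤ n) : IsPolyOfDegreeLE n f :=
  let ⟨Q, hQ, e⟩ := hf
  ⟨Q, hQ.trans h, e⟩

theorem coord (i : ι) : IsPolyOfDegreeLE 1 fun x => x i :=
  ⟨MvPolynomial.X i, by simp, by simp⟩

theorem const (a : ℝ) : IsPolyOfDegreeLE (ι := ι) 0 fun _ => a :=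
  ⟨MvPolynomial.C a, by simp, by simp⟩

theorem add (hf : IsPolyOfDegreeLE m f) (hg : IsPolyOfDegreeLE n g) :
    IsPolyOfDegreeLE (max m n) fun x => f x + g x := by
  obtain ⟨Q, hQ, e⟩ := hf
  obtain ⟨R, hR, e'⟩ := hg
  exact ⟨Q + R, (MvPolynomial.totalDegree_add _ _).trans (max_le_max hQ hR), by simp [e, e']⟩

theorem sub (hf : IsPolyOfDegreeLE m f) (hg : IsPolyOfDegreeLE n g) :
    IsPolyOfDegreeLE (max m n) fun x => f x - g x := by
  obtain ⟨Q, hQ, e⟩ := hf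
  obtain ⟨R, hR, e'⟩ := hg
  exact ⟨Q - R, (MvPolynomial.totalDegree_sub _ _).trans (max_le_max hQ hR), by simp [e, e']⟩

theorem mul (hf : IsPolyOfDegreeLE m f) (hg : IsPolyOfDegreeLE n g) :
    IsPolyOfDegreeLE (m + n) fun x => f x * g x := by
  obtain ⟨Q, hQ, e⟩ := hf
  obtain ⟨R, hR, e'⟩ := hg
  exact ⟨Q * R, (MvPolynomial.totalDegree_mul _ _).trans (add_le_add hQ hR), by simp [e, e']⟩

theorem pow (hf : IsPolyOfDegreeLE m f) (k : ℕ) : IsPolyOfDegreeLE (k * m) fun x => f x ^ k := by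
  obtain ⟨Q, hQ, e⟩ := hf
  exact ⟨Q ^ k, (MvPolynomial.totalDegree_pow _ _).trans (Nat.mul_le_mul_left k hQ), by simp [e]⟩

theorem sum {K : Type*} {s : Finset K} {f : K → (ι → ℝ) → ℝ}
    (hf : ∀ k ∈ s, IsPolyOfDegreeLE n (f k)) : IsPolyOfDegreeLE n fun x => ∑ k ∈ s, f k x := by
  choose! Q hQ e using hf
  refine ⟨∑ k ∈ s, Q k, MvPolynomial.totalDegree_finsetSum_le hQ, fun x => ?_⟩
  rw [map_sum]
  exact Finset.sum_congr rfl fun k hk => e k hk x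

theorem prod {K : Type*} {s : Finset K} {f : K → (ι → ℝ) → ℝ}
    (hf : ∀ k ∈ s, IsPolyOfDegreeLE n (f k)) :
    IsPolyOfDegreeLE (s.card * n) fun x => ∏ k ∈ s, f k x := by
  choose! Q hQ e using hf
  refine ⟨∏ k ∈ s, Q k, ?_, fun x => ?_⟩
  · refine (MvPolynomial.totalDegree_finsetProd _ _).trans ?_
    exact (Finset.sum_le_card_nsmul _ _ _ hQ).trans (by simp)
  · rw [map_prod]
    exact Finset.prod_congr rfl fun k hk => e k hk x

end IsPolyOfDegreeLE

section

variable {ι : P → Type}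

/-- A family of polynomial functions of degree bounded uniformly in the parameters. -/
def PolyFamily (f : ∀ p, (ι p → ℝ) → ℝ) : Prop := ∃ n, ∀ p, IsPolyOfDegreeLE n (f p)

namespace PolyFamily

variable {f g : ∀ p, (ι p → ℝ) → ℝ}

theorem coord (i : ∀ p, ι p) : PolyFamily fun p (x : ι p → ℝ) => x (i p) :=
  ⟨1, fun p => .coord (i p)⟩

theorem const (a : ℝ) : PolyFamily fun p (_ : ι p → ℝ) => a :=
  ⟨0, fun _ => .const a⟩

theorem add (hf : PolyFamily f) (hg : PolyFamily g) : PolyFamily fun p x => f p x + g p x :=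
  let ⟨_, hm⟩ := hf
  let ⟨_, hn⟩ := hg
  ⟨_, fun p => (hm p).add (hn p)⟩

theorem sub (hf : PolyFamily f) (hg : PolyFamily g) : PolyFamily fun p x => f p x - g p x :=
  let ⟨_, hm⟩ := hf
  let ⟨_, hn⟩ := hg
  ⟨_, fun p => (hm p).sub (hn p)⟩

theorem mul (hf : PolyFamily f) (hg : PolyFamily g) : PolyFamily fun p x => f p x * g p x :=
  let ⟨_, hm⟩ := hf
  let ⟨_, hn⟩ := hg
  ⟨_, fun p => (hm p).mul (hn p)⟩

theorem pow (hf : PolyFamily f) (k : ℕ) : PolyFamily fun p x => f p x ^ k :=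
  let ⟨_, hm⟩ := hf
  ⟨_, fun p => (hm p).pow k⟩

theorem sum {K : Type*} {s : Finset K} {f : K → ∀ p, (ι p → ℝ) → ℝ}
    (hf : ∀ k ∈ s, PolyFamily (f k)) : PolyFamily fun p x => ∑ k ∈ s, f k p x := by
  choose! n hn using hf
  exact ⟨s.sup n, fun p => .sum fun k hk => (hn k hk p).mono (Finset.le_sup hk)⟩

end PolyFamily

end

theorem Sharp.eq_zero (hΩ : IsPresharp Ω) (hι : BddVars sc ι) {f : ∀ p, (ι p → ℝ) → ℝ}
    (q : MvPolynomial (Fin 2) ℕ) (hf : ∀ p, IsPolyOfDegreeLE (sc.val q p) (f p)) :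
    Sharp Ω sc fun p x => f p x = 0 := by
  obtain ⟨b, hb⟩ := hι
  refine ⟨b, q, fun p => ?_⟩
  obtain ⟨Q, hQ, e⟩ := hf p
  have h1 := hΩ.zeros _ (MvPolynomial.rename (Fintype.equivFin (ι p)) Q)
  have h2 := Ω.sets_mono (hb p) ((MvPolynomial.totalDegree_rename_le _ _).trans hQ) h1
  simpa [e, MvPolynomial.eval_rename, Function.comp_def] using h2

theorem Sharp.nonneg (hΩ : IsPresharp Ω) (hι : BddVars sc ι) {f : ∀ p, (ι p → ℝ) → ℝ}
    (q : MvPolynomial (Fin 2) ℕ) (hf : ∀ p, IsPolyOfDegreeLE (sc.val q p) (f p)) :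
    Sharp Ω sc fun p x => 0 ≤ f p x := by
  have h : Sharp Ω sc fun p (x : ι p → ℝ) => ∃ t : ℝ, f p x - t ^ 2 = 0 := by
    refine Sharp.ex_real hΩ ?_
    refine Sharp.eq_zero hΩ (hι.sum (.const Unit)) (q + MvPolynomial.C 2) fun p => ?_
    obtain ⟨Q, hQ, e⟩ := hf p
    have h1 : IsPolyOfDegreeLE (sc.val q p) fun z : ι p ⊕ Unit → ℝ => f p fun i => z (Sum.inl i) :=
      ⟨MvPolynomial.rename Sum.inl Q, (MvPolynomial.totalDegree_rename_le _ _).trans hQ,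
        fun z => by simp [e, MvPolynomial.eval_rename, Function.comp_def]⟩
    refine (h1.sub ((IsPolyOfDegreeLE.coord (Sum.inr ())).pow 2)).mono ?_
    simp [Scale.val]
  refine h.congr fun p x => ⟨fun hx => ⟨Real.sqrt (f p x), by rw [Real.sq_sqrt hx, sub_self]⟩, ?_⟩
  rintro ⟨t, ht⟩
  nlinarith [sq_nonneg t]


variable {f g : ∀ p, (ι p → ℝ) → ℝ}

theorem Sharp.poly_le (hΩ : IsPresharp Ω) (hι : BddVars sc ι) (hf : PolyFamily f)
    (hg : PolyFamily g) : Sharp Ω sc fun p x => f p x ≤ g p x := by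
  obtain ⟨n, hn⟩ := hg.sub hf
  refine (Sharp.nonneg hΩ hι (MvPolynomial.C n) (f := fun p x => g p x - f p x)
    fun p => ?_).congr fun p x => sub_nonneg.symm
  simpa [Scale.val] using hn p

theorem Sharp.poly_lt (hΩ : IsPresharp Ω) (hι : BddVars sc ι) (hf : PolyFamily f)
    (hg : PolyFamily g) : Sharp Ω sc fun p x => f p x < g p x :=
  ((Sharp.poly_le hΩ hι hg hf).not hΩ).congr fun _ _ => not_le.symm

theorem Sharp.poly_eq (hΩ : IsPresharp Ω) (hι : BddVars sc ι) (hf : PolyFamily f)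
    (hg : PolyFamily g) : Sharp Ω sc fun p x => f p x = g p x :=
  ((Sharp.poly_le hΩ hι hf hg).and hΩ (Sharp.poly_le hΩ hι hg hf)).congr
    fun _ _ => le_antisymm_iff

theorem Sharp.exists_finset (hΩ : IsPresharp Ω) (hι : BddVars sc ι) {K : Type*} (s : Finset K)
    {A : K → ∀ p, (ι p → ℝ) → Prop} (hA : ∀ k ∈ s, Sharp Ω sc (A k)) :
    Sharp Ω sc fun p x => ∃ k ∈ s, A k p x := by
  classical
  induction s using Finset.induction_on with
  | empty =>
    refine (Sharp.poly_lt hΩ hι (.const 0) (.const 0)).congr fun p x => ?_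
    simp
  | insert a s ha ih =>
    refine ((hA a (by simp)).or hΩ (ih fun k hk => hA k (by simp [hk]))).congr fun p x => ?_
    simp

theorem Sharp.forall_finset (hΩ : IsPresharp Ω) (hι : BddVars sc ι) {K : Type*} (s : Finset K)
    {A : K → ∀ p, (ι p → ℝ) → Prop} (hA : ∀ k ∈ s, Sharp Ω sc (A k)) :
    Sharp Ω sc fun p x => ∀ k ∈ s, A k p x :=
  ((Sharp.exists_finset hΩ hι s fun k hk => (hA k hk).not hΩ).not hΩ).congr fun p x => by simp

open Filter Topology

/-! ### Definable conditions and Baire category -/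

section Baire

variable {X : Type*} [TopologicalSpace X] [BaireSpace X]

/-- Every nonempty open set has a nonempty open subset on which `A` is constant. -/
def GenericallyConstant (A : X → Prop) : Prop :=
  ∀ U : Set X, IsOpen U → U.Nonempty →
    ∃ V ⊆ U, IsOpen V ∧ V.Nonempty ∧ ((∀ x ∈ V, A x) ∨ ∀ x ∈ V, ¬ A x)

/-- A generically constant set without interior points in `U` is nowhere dense there, so Baire's
theorem applies to countable covers by such sets. -/
theorem exists_open_subset_of_countable_cover {K : Type*} [Countable K] {A : K → X → Prop}
    (hA : ∀ k, GenericallyConstant (A k)) {U : Set X} (hU : IsOpen U) (hne : U.Nonempty)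
    (hcov : ∀ x ∈ U, ∃ k, A k x) :
    ∃ k, ∃ V ⊆ U, IsOpen V ∧ V.Nonempty ∧ ∀ x ∈ V, A k x := by
  by_contra! hcon
  refine not_isMeagre_of_isOpen hU hne ?_
  have hsub : U ⊆ ⋃ k, {x ∈ U | A k x} := fun x hx => by
    obtain ⟨k, hk⟩ := hcov x hx
    exact mem_iUnion.2 ⟨k, hx, hk⟩
  refine (isMeagre_iUnion fun k => IsNowhereDense.isMeagre ?_).mono hsub
  rw [IsNowhereDense, ← not_nonempty_iff_eq_empty]
  rintro ⟨x, hx⟩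
  have hcl : x ∈ closure {x ∈ U | A k x} := interior_subset hx
  obtain ⟨y, hy, hyU, -⟩ := mem_closure_iff.1 hcl _ isOpen_interior hx
  obtain ⟨V, hVU, hVo, hVne, hV⟩ := hA k _ (isOpen_interior.inter hU) ⟨y, hy, hyU⟩
  rcases hV with hV | hV
  · obtain ⟨z, hz, hz'⟩ := hcon k V (hVU.trans inter_subset_right) hVo hVne
    exact hz' (hV z hz)
  · obtain ⟨z, hz⟩ := hVne
    obtain ⟨w, hw, -, hw'⟩ := mem_closure_iff.1 (interior_subset (hVU hz).1) _ hVo hz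
    exact hV w hw hw'

end Baire

theorem IsFiniteUnionOfIntervals.eventually_nhdsGT {A : Set ℝ} (hA : IsFiniteUnionOfIntervals A)
    (x : ℝ) : (∀ᶠ y in 𝓝[>] x, y ∈ A) ∨ ∀ᶠ y in 𝓝[>] x, y ∉ A := by
  obtain ⟨I, hI, hc, rfl⟩ := hA
  by_cases h : ∃ J ∈ I, ∃ᶠ y in 𝓝[>] x, y ∈ J
  · obtain ⟨J, hJ, hf⟩ := h
    left
    obtain ⟨y, hy, hxy⟩ := (hf.and_eventually self_mem_nhdsWithin).exists
    filter_upwards [Ioo_mem_nhdsGT hxy] with z hz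
    obtain ⟨w, hw, hxw⟩ := (hf.and_eventually (Ioo_mem_nhdsGT hz.1)).exists
    exact ⟨J, hJ, (hc J hJ).out hw hy ⟨hxw.2.le, hz.2.le⟩⟩
  · right
    push Not at h
    have : ∀ᶠ y in 𝓝[>] x, ∀ J ∈ I, y ∉ J :=
      (eventually_all_finite hI).2 fun J hJ => h J hJ
    filter_upwards [this] with y hy
    rintro ⟨J, hJ, hyJ⟩
    exact hy J hJ hyJ

variable {S : OMinimalExpansion} {Ω : FDFiltration S}

/-- A condition on finitely many real variables that cuts out a definable set: a sharp family with a
single member. -/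
abbrev IsDef (Ω : FDFiltration S) {ι : Type} [Fintype ι] (A : (ι → ℝ) → Prop) : Prop :=
  Sharp Ω (⟨fun _ : Unit => 0, fun _ => 0, fun _ => 0⟩ : Scale Unit) (ι := fun _ => ι) fun _ => A

variable {ι κ : Type} [Fintype ι] [Fintype κ]

theorem isDef_of_mem (hΩ : IsPresharp Ω) {ℓ : ℕ} {X : Set (Fin ℓ → ℝ)} (hX : X ∈ S.Def ℓ) :
    IsDef Ω fun x => x ∈ X := by
  obtain ⟨F, D, h⟩ := Ω.exhaustive ℓ X hX
  refine Sharp.of_mem_sets_fin hΩ (c := fun _ _ => F) (q := MvPolynomial.C D) fun p => ?_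
  simpa [Scale.val] using h

theorem IsDef.mem_def (hΩ : IsPresharp Ω) {ℓ : ℕ} {A : (Fin ℓ → ℝ) → Prop} (hA : IsDef Ω A) :
    {x | A x} ∈ S.Def ℓ := by
  obtain ⟨c, q, h⟩ := Sharp.mem_sets_fin hΩ hA
  exact Ω.definable _ _ _ (h ())

theorem IsDef.comp_poly (hΩ : IsPresharp Ω) {A : (ι → ℝ) → Prop} (hA : IsDef Ω A)
    {g : ι → (κ → ℝ) → ℝ}
    (hg : ∀ i, PolyFamily (P := Unit) (ι := fun _ => κ) fun _ => g i) :
    IsDef Ω fun z => A fun i => g i z := by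
  have h : IsDef Ω fun z : κ → ℝ => ∃ x : ι → ℝ, A x ∧ ∀ i ∈ Finset.univ, x i - g i z = 0 := by
    refine Sharp.ex hΩ (Sharp.and hΩ (Sharp.subst hΩ hA (.const _) fun _ i => Sum.inr i) ?_)
    refine Sharp.forall_finset hΩ (.const _) _ fun i _ => ?_
    refine Sharp.poly_eq hΩ (.const _) ?_ (.const 0)
    refine (PolyFamily.coord fun _ => Sum.inr i).sub ?_
    obtain ⟨n, hn⟩ := hg i
    obtain ⟨Q, hQ, e⟩ := hn ()
    exact ⟨n, fun _ => ⟨MvPolynomial.rename Sum.inl Q,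
      (MvPolynomial.totalDegree_rename_le _ _).trans hQ,
      fun z => by simp [e, MvPolynomial.eval_rename, Function.comp_def]⟩⟩
  refine h.congr fun _ z => ⟨fun hz => ⟨fun i => g i z, hz, by simp⟩, ?_⟩
  rintro ⟨x, hx, e⟩
  have : x = fun i => g i z := funext fun i => sub_eq_zero.1 (e i (Finset.mem_univ i))
  rwa [← this]

/-- Definable subsets of lines are finite unions of intervals. -/
theorem IsDef.line (hΩ : IsPresharp Ω) {A : (ι → ℝ) → Prop} (hA : IsDef Ω A)
    {g : ι → (Fin 1 → ℝ) → ℝ}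
    (hg : ∀ i, PolyFamily (P := Unit) (ι := fun _ => Fin 1) fun _ => g i) :
    IsFiniteUnionOfIntervals {t | A fun i => g i fun _ => t} := by
  rw [← S.mem_one_iff]
  convert (hA.comp_poly hΩ hg).mem_def hΩ using 1
  ext x
  have : (fun _ => x 0) = x := funext fun i => by rw [Subsingleton.elim i 0]
  simp [this]

/-- An interval of length `1/(n+1)` to the right of `x` on which a definable condition is constant. -/
theorem IsFiniteUnionOfIntervals.exists_Ioo {A : Set ℝ} (hA : IsFiniteUnionOfIntervals A) (x : ℝ) :
    ∃ n : ℕ, Ioo x (x + 1 / (n + 1)) ⊆ A ∨ Ioo x (x + 1 / (n + 1)) ⊆ Aᶜ := by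
  have key : ∀ B : Set ℝ, (∀ᶠ y in 𝓝[>] x, y ∈ B) → ∃ n : ℕ, Ioo x (x + 1 / (n + 1)) ⊆ B := by
    intro B hB
    obtain ⟨u, hu, hB⟩ := (mem_nhdsGT_iff_exists_Ioo_subset).1 hB
    obtain ⟨n, hn⟩ := exists_nat_one_div_lt (sub_pos.2 hu : 0 < u - x)
    exact ⟨n, (Ioo_subset_Ioo_right (by linarith)).trans hB⟩
  rcases hA.eventually_nhdsGT x with h | h
  · obtain ⟨n, hn⟩ := key _ h
    exact ⟨n, .inl hn⟩
  · obtain ⟨n, hn⟩ := key _ h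
    exact ⟨n, .inr hn⟩

/-- The induction step covers the base by the countably many conditions that `A` is constant on a fixed
interval with rational end points in the last variable. -/
theorem IsDef.genericallyConstant_fin (hΩ : IsPresharp Ω) {n : ℕ} {A : (Fin n → ℝ) → Prop}
    (hA : IsDef Ω A) : GenericallyConstant A := by
  induction n with
  | zero =>
    rintro U hU ⟨x, hx⟩
    refine ⟨U, subset_rfl, hU, ⟨x, hx⟩, ?_⟩
    by_cases h : A x
    · exact .inl fun y _ => Subsingleton.elim x y ▸ h
    · exact .inr fun y _ => Subsingleton.elim x y ▸ h
  | succ n ih =>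
    rintro U hU ⟨x, hx⟩
    obtain ⟨ε, hε, hball⟩ := Metric.isOpen_iff.1 hU x hx
    let u₀ : Fin n → ℝ := fun i => x i.castSucc
    have hsnoc : ∀ u t, u ∈ Metric.ball u₀ ε → t ∈ Ioo (x (Fin.last n) - ε) (x (Fin.last n) + ε) →
        (Fin.snoc u t : Fin (n + 1) → ℝ) ∈ U := by
      intro u t hu ht
      refine hball ?_
      rw [Metric.mem_ball, dist_pi_lt_iff hε] at hu ⊢
      intro i
      refine Fin.lastCases ?_ (fun i => ?_) i
      · rw [Fin.snoc_last, Real.dist_eq, abs_lt]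
        constructor <;> linarith [ht.1, ht.2]
      · simpa using hu i
    let C : (ℚ × ℚ) × Bool → (Fin n → ℝ) → Prop := fun k u =>
      k.1.1 < k.1.2 ∧ Ioo (k.1.1 : ℝ) k.1.2 ⊆ Ioo (x (Fin.last n) - ε) (x (Fin.last n) + ε) ∧
      ∀ t : ℝ, (k.1.1 : ℝ) < t → t < k.1.2 → (A (Fin.snoc u t) ↔ k.2 = true)
    have hC : ∀ k, GenericallyConstant (C k) := by
      intro k
      by_cases hk : k.1.1 < k.1.2 ∧
          Ioo (k.1.1 : ℝ) k.1.2 ⊆ Ioo (x (Fin.last n) - ε) (x (Fin.last n) + ε)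
      swap
      · rintro U hU hne
        refine ⟨U, subset_rfl, hU, hne, .inr fun y _ hy => hk ⟨hy.1, hy.2.1⟩⟩
      refine ih (A := C k) ?_
      have h : IsDef Ω fun u : Fin n → ℝ => ∀ t : ℝ, (k.1.1 : ℝ) < t → t < k.1.2 →
          (A (Fin.snoc u t) ↔ k.2 = true) := by
        refine Sharp.all_real hΩ ?_
        refine .imp hΩ (.poly_lt hΩ (.const _) (.const _) (.coord fun _ => Sum.inr ())) ?_
        refine .imp hΩ (.poly_lt hΩ (.const _) (.coord fun _ => Sum.inr ()) (.const _)) ?_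
        have h1 : IsDef Ω fun z : Fin n ⊕ Unit → ℝ =>
            A (Fin.snoc (fun i => z (Sum.inl i)) (z (Sum.inr ()))) := by
          refine (Sharp.subst hΩ hA (.const _)
            fun _ => (Fin.snoc (α := fun _ => Fin n ⊕ Unit) Sum.inl (Sum.inr ()))).congr
            fun _ z => ?_
          suffices h : (Fin.snoc (fun i => z (Sum.inl i)) (z (Sum.inr ())) : Fin (n + 1) → ℝ) =
              fun i => z (Fin.snoc (α := fun _ => Fin n ⊕ Unit) Sum.inl (Sum.inr ()) i) by rw [h]
          funext i
          refine Fin.lastCases ?_ (fun i => ?_) i <;> simp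
        cases hb : k.2
        · simpa using h1.not hΩ
        · simpa using h1
      exact h.congr fun _ u => ⟨fun hu => hu.2.2, fun hu => ⟨hk.1, hk.2, hu⟩⟩
    have hcov : ∀ u ∈ Metric.ball u₀ ε, ∃ k, C k u := by
      intro u _
      have hline := hA.line hΩ
        (g := fun j z => Fin.snoc (α := fun _ => ℝ) u (z 0) j) fun j => by
          refine Fin.lastCases ?_ (fun i => ?_) j
          · simpa using PolyFamily.coord fun _ => (0 : Fin 1)
          · simpa using PolyFamily.const (u i)
      obtain ⟨m, hm⟩ := hline.exists_Ioo (x (Fin.last n))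
      have hm0 : (0 : ℝ) < 1 / (m + 1) := by positivity
      set b := min (x (Fin.last n) + 1 / (m + 1)) (x (Fin.last n) + ε)
      obtain ⟨q, hq1, hq2⟩ := exists_rat_btwn
        (lt_min (by linarith) (by linarith) : x (Fin.last n) < b)
      obtain ⟨q', hq'1, hq'2⟩ := exists_rat_btwn hq2
      have hb1 : b ≤ x (Fin.last n) + 1 / (m + 1) := min_le_left _ _
      have hb2 : b ≤ x (Fin.last n) + ε := min_le_right _ _
      have hs : Ioo (q : ℝ) q' ⊆ Ioo (x (Fin.last n)) (x (Fin.last n) + 1 / (m + 1)) :=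
        Ioo_subset_Ioo hq1.le (by linarith)
      have hs' : Ioo (q : ℝ) q' ⊆ Ioo (x (Fin.last n) - ε) (x (Fin.last n) + ε) :=
        Ioo_subset_Ioo (by linarith) (by linarith)
      rcases hm with hm | hm
      · exact ⟨((q, q'), true), by exact_mod_cast hq'1, hs',
          fun t h1 h2 => by simpa using hm (hs ⟨h1, h2⟩)⟩
      · exact ⟨((q, q'), false), by exact_mod_cast hq'1, hs',
          fun t h1 h2 => by simpa using hm (hs ⟨h1, h2⟩)⟩
    obtain ⟨k, V, hVU, hVo, ⟨v, hv⟩, hV⟩ := exists_open_subset_of_countable_cover hC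
      Metric.isOpen_ball ⟨u₀, Metric.mem_ball_self hε⟩ hcov
    let W : Set (Fin (n + 1) → ℝ) :=
      {y | (fun i : Fin n => y i.castSucc) ∈ V ∧ y (Fin.last n) ∈ Ioo (k.1.1 : ℝ) k.1.2}
    have hWA : ∀ y ∈ W, y ∈ U ∧ (A y ↔ k.2 = true) := by
      rintro y ⟨h1, h2⟩
      have e : y = Fin.snoc (fun i : Fin n => y i.castSucc) (y (Fin.last n)) := by
        funext i
        refine Fin.lastCases ?_ (fun i => ?_) i <;> simp
      rw [e]
      exact ⟨hsnoc _ _ (hVU h1) ((hV _ h1).2.1 h2), (hV _ h1).2.2 _ h2.1 h2.2⟩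
    refine ⟨W, fun y hy => (hWA y hy).1, ?_, ?_, ?_⟩
    · exact (hVo.preimage (by fun_prop)).inter (isOpen_Ioo.preimage (by fun_prop))
    · have hk : (k.1.1 : ℝ) < k.1.2 := by exact_mod_cast (hV v hv).1
      obtain ⟨t, ht⟩ := nonempty_Ioo.2 hk
      exact ⟨Fin.snoc v t, by simpa [W] using ⟨hv, ht⟩⟩
    · cases hb : k.2
      · exact .inr fun y hy => by simpa [hb] using (hWA y hy).2
      · exact .inl fun y hy => by simpa [hb] using (hWA y hy).2

/-- A definable set or its complement has interior points in any given open set. -/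
theorem IsDef.genericallyConstant (hΩ : IsPresharp Ω) {A : (ι → ℝ) → Prop} (hA : IsDef Ω A) :
    GenericallyConstant A := by
  intro U hU ⟨x, hx⟩
  let e := Fintype.equivFin ι
  have h1 : IsDef Ω fun z : Fin (Fintype.card ι) → ℝ => A fun i => z (e i) :=
    Sharp.subst hΩ hA (.const _) fun _ i => e i
  obtain ⟨V, hVU, hVo, ⟨v, hv⟩, hV⟩ := h1.genericallyConstant_fin hΩ
    {z | (fun i => z (e i)) ∈ U} (hU.preimage (by fun_prop)) ⟨fun i => x (e.symm i), by simpa⟩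
  refine ⟨{y | (fun i => y (e.symm i)) ∈ V}, fun y hy => by simpa using hVU hy,
    hVo.preimage (by fun_prop), ⟨fun i => v (e i), by simpa⟩, ?_⟩
  exact hV.imp (fun h y hy => by simpa using h _ hy) (fun h y hy => by simpa using h _ hy)

theorem IsDef.exists_open_of_cover (hΩ : IsPresharp Ω) {K : Type*} [Countable K]
    {A : K → (ι → ℝ) → Prop} (hA : ∀ k, IsDef Ω (A k)) {U : Set (ι → ℝ)} (hU : IsOpen U)
    (hne : U.Nonempty) (hcov : ∀ x ∈ U, ∃ k, A k x) :
    ∃ k, ∃ V ⊆ U, IsOpen V ∧ V.Nonempty ∧ ∀ x ∈ V, A k x :=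
  exists_open_subset_of_countable_cover (fun k => (hA k).genericallyConstant hΩ) hU hne hcov

/-! ### Generic differentiability of definable functions -/

variable {S : OMinimalExpansion} {Ω : FDFiltration S} {ι κ : Type} [Fintype ι] [Fintype κ]

/-- A function on all of `ℝ^ι` with definable graph; the variable `Sum.inr ()` is the value. -/
abbrev IsDefFun (Ω : FDFiltration S) (f : (ι → ℝ) → ℝ) : Prop :=
  IsDef Ω fun z : ι ⊕ Unit → ℝ => z (Sum.inr ()) = f fun i => z (Sum.inl i)

variable {f : (ι → ℝ) → ℝ}

/-- A value of a definable function may be substituted for a variable of a definable condition. -/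
theorem IsDefFun.app (hΩ : IsPresharp Ω) (hf : IsDefFun Ω f) (σ : ι → κ)
    (A : (κ → ℝ) → ℝ → Prop)
    (hA : IsDef Ω fun z : κ ⊕ Unit → ℝ => A (fun i => z (Sum.inl i)) (z (Sum.inr ()))) :
    IsDef Ω fun z => A z (f fun i => z (σ i)) := by
  have h : IsDef Ω fun z : κ → ℝ => ∃ t : ℝ, t = (f fun i => z (σ i)) ∧ A z t := by
    refine Sharp.ex_real hΩ (Sharp.and hΩ ?_ hA)
    exact Sharp.subst hΩ hf (.const _) fun _ => Sum.map σ id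
  exact h.congr fun _ z => by simp

/-- A definable function is bounded on some open subset. -/
theorem IsDefFun.exists_open_bounded (hΩ : IsPresharp Ω) (hf : IsDefFun Ω f)
    {U : Set (ι → ℝ)} (hU : IsOpen U) (hne : U.Nonempty) :
    ∃ M : ℝ, ∃ V ⊆ U, IsOpen V ∧ V.Nonempty ∧ ∀ x ∈ V, |f x| ≤ M := by
  have hA : ∀ n : ℕ, IsDef Ω fun x : ι → ℝ => f x ^ 2 ≤ (n : ℝ) ^ 2 := fun n =>
    IsDefFun.app hΩ hf id (fun _ a => a ^ 2 ≤ (n : ℝ) ^ 2)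
      (.poly_le hΩ (.const _) (.pow (.coord fun _ => Sum.inr ()) 2) (.const _))
  obtain ⟨n, V, hVU, hVo, hVne, hV⟩ := IsDef.exists_open_of_cover hΩ hA hU hne fun x _ => by
    obtain ⟨n, hn⟩ := exists_nat_ge |f x|
    exact ⟨n, sq_le_sq.2 (by simpa using hn)⟩
  exact ⟨n, V, hVU, hVo, hVne, fun x hx => by simpa using sq_le_sq.1 (hV x hx)⟩

theorem hasDerivAt_iff_sq {g : ℝ → ℝ} {a v : ℝ} : HasDerivAt g v a ↔
    ∀ ε : ℝ, 0 < ε → ∃ δ : ℝ, 0 < δ ∧ ∀ t : ℝ, (t - a) ^ 2 < δ ^ 2 →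
      (g t - g a - v * (t - a)) ^ 2 ≤ (ε * (t - a)) ^ 2 := by
  rw [hasDerivAt_iff_isLittleO, Asymptotics.isLittleO_iff]
  constructor
  · intro h ε hε
    obtain ⟨δ, hδ, h⟩ := Metric.eventually_nhds_iff.1 (h hε)
    refine ⟨δ, hδ, fun t ht => ?_⟩
    have := h (y := t) (by rw [Real.dist_eq]; exact abs_lt_of_sq_lt_sq ht hδ.le)
    rw [sq_le_sq, abs_mul, abs_of_pos hε]
    simpa [mul_comm] using this
  · intro h ε hε
    obtain ⟨δ, hδ, h⟩ := h ε hε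
    refine Metric.eventually_nhds_iff.2 ⟨δ, hδ, fun {t} ht => ?_⟩
    have := h t (by rw [Real.dist_eq] at ht; exact sq_lt_sq.2 (by rwa [abs_of_pos hδ]))
    rw [sq_le_sq, abs_mul, abs_of_pos hε] at this
    simpa [mul_comm] using this

variable [DecidableEq ι]

theorem IsDefFun.hasDerivAt (hΩ : IsPresharp Ω) (hf : IsDefFun Ω f) (i : ι) :
    IsDef Ω fun z : ι ⊕ Unit → ℝ =>
      HasDerivAt (fun t => f (Function.update (fun j => z (Sum.inl j)) i t))
        (z (Sum.inr ())) (z (Sum.inl i)) := by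
  have h : IsDef Ω fun z : ι ⊕ Unit → ℝ => ∀ ε : ℝ, 0 < ε → ∃ δ : ℝ, 0 < δ ∧ ∀ t : ℝ,
      (t - z (Sum.inl i)) ^ 2 < δ ^ 2 →
      (f (Function.update (fun j => z (Sum.inl j)) i t) - f (fun j => z (Sum.inl j))
        - z (Sum.inr ()) * (t - z (Sum.inl i))) ^ 2 ≤ (ε * (t - z (Sum.inl i))) ^ 2 := by
    refine Sharp.all_real hΩ (.imp hΩ (.poly_lt hΩ (.const _) (.const _)
      (.coord fun _ => Sum.inr ())) ?_)
    refine Sharp.ex_real hΩ (.and hΩ (.poly_lt hΩ (.const _) (.const _)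
      (.coord fun _ => Sum.inr ())) ?_)
    refine Sharp.all_real hΩ (.imp hΩ (.poly_lt hΩ (.const _)
      (((PolyFamily.coord fun _ => Sum.inr ()).sub
        (.coord fun _ => Sum.inl (Sum.inl (Sum.inl (Sum.inl i))))).pow 2)
      ((PolyFamily.coord fun _ => Sum.inl (Sum.inr ())).pow 2)) ?_)
    have h1 := IsDefFun.app hΩ hf
      (fun j => Sum.inl (Sum.inl (Sum.inl (Sum.inl j))) : ι → (((ι ⊕ Unit) ⊕ Unit) ⊕ Unit) ⊕ Unit)
      (fun z a => (f (fun j => z (if j = i then Sum.inr ()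
          else Sum.inl (Sum.inl (Sum.inl (Sum.inl j))))) - a
        - z (Sum.inl (Sum.inl (Sum.inl (Sum.inr ())))) * (z (Sum.inr ()) -
          z (Sum.inl (Sum.inl (Sum.inl (Sum.inl i)))))) ^ 2
        ≤ (z (Sum.inl (Sum.inl (Sum.inr ()))) * (z (Sum.inr ()) -
          z (Sum.inl (Sum.inl (Sum.inl (Sum.inl i)))))) ^ 2) ?_
    · refine h1.congr fun _ z => ?_
      have : (Function.update (fun j => z (Sum.inl (Sum.inl (Sum.inl (Sum.inl j))))) i
          (z (Sum.inr ()))) = fun j => z (if j = i then Sum.inr ()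
          else Sum.inl (Sum.inl (Sum.inl (Sum.inl j)))) := by
        funext j
        by_cases hj : j = i
        · subst hj; simp
        · simp [hj]
      rw [this]
    · refine IsDefFun.app hΩ hf (fun j => Sum.inl (if j = i then Sum.inr ()
          else Sum.inl (Sum.inl (Sum.inl (Sum.inl j)))))
        (fun z b => (b - z (Sum.inr ())
          - z (Sum.inl (Sum.inl (Sum.inl (Sum.inl (Sum.inr ()))))) * (z (Sum.inl (Sum.inr ())) -
          z (Sum.inl (Sum.inl (Sum.inl (Sum.inl (Sum.inl i))))))) ^ 2
        ≤ (z (Sum.inl (Sum.inl (Sum.inl (Sum.inr ())))) * (z (Sum.inl (Sum.inr ())) -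
          z (Sum.inl (Sum.inl (Sum.inl (Sum.inl (Sum.inl i))))))) ^ 2) ?_
      refine Sharp.poly_le hΩ (.const _) (.pow (.sub (.sub ?_ ?_) (.mul ?_ (.sub ?_ ?_))) 2)
        (.pow (.mul ?_ (.sub ?_ ?_)) 2) <;> exact .coord _
  refine h.congr fun _ z => ?_
  rw [hasDerivAt_iff_sq]
  have : Function.update (fun j => z (Sum.inl j)) i (z (Sum.inl i)) = fun j => z (Sum.inl j) := by
    funext j
    by_cases hj : j = i
    · subst hj; simp
    · simp [hj]
  simp only [this]

/-- The partial derivative in the direction of the `i`-th coordinate, `0` where it does not exist. -/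
noncomputable def partialDeriv (f : (ι → ℝ) → ℝ) (i : ι) (x : ι → ℝ) : ℝ :=
  deriv (fun t => f (Function.update x i t)) (x i)

theorem IsDefFun.differentiableAt (hΩ : IsPresharp Ω) (hf : IsDefFun Ω f) (i : ι) :
    IsDef Ω fun x => DifferentiableAt ℝ (fun t => f (Function.update x i t)) (x i) := by
  have h : IsDef Ω fun x : ι → ℝ => ∃ v, HasDerivAt (fun t => f (Function.update x i t)) v (x i) :=
    Sharp.ex_real hΩ (hf.hasDerivAt hΩ i)
  exact h.congr fun _ x => ⟨fun hx => ⟨_, hx.hasDerivAt⟩, fun ⟨v, hv⟩ => hv.differentiableAt⟩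

theorem IsDefFun.isDefFun_partialDeriv (hΩ : IsPresharp Ω) (hf : IsDefFun Ω f) (i : ι) :
    IsDefFun Ω (partialDeriv f i) := by
  have h1 := hf.hasDerivAt hΩ i
  have h2 : IsDef Ω fun z : ι ⊕ Unit → ℝ => DifferentiableAt ℝ
      (fun t => f (Function.update (fun j => z (Sum.inl j)) i t)) (z (Sum.inl i)) :=
    Sharp.subst hΩ (hf.differentiableAt hΩ i) (.const _) fun _ => Sum.inl
  have h3 : IsDef Ω fun z : ι ⊕ Unit → ℝ => z (Sum.inr ()) = 0 :=
    Sharp.poly_eq hΩ (.const _) (.coord fun _ => Sum.inr ()) (.const 0)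
  refine (h1.or hΩ ((h2.not hΩ).and hΩ h3)).congr fun _ z => ?_
  unfold partialDeriv
  constructor
  · intro h
    by_cases hd : DifferentiableAt ℝ (fun t => f (Function.update (fun j => z (Sum.inl j)) i t))
        (z (Sum.inl i))
    · exact .inl (h ▸ hd.hasDerivAt)
    · exact .inr ⟨hd, by rw [h, deriv_zero_of_not_differentiableAt hd]⟩
  · rintro (h | ⟨hd, h⟩)
    · exact h.deriv.symm
    · rw [h, deriv_zero_of_not_differentiableAt hd]

/-- Near every point and in every direction, the values to the right of the point are eventually all
at least, or all less than, the value at the point. By Baire's theorem the length of the interval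
involved can be fixed on an open set, where the function is then monotone in that direction, and
Lebesgue's theorem on monotone functions gives a point of differentiability. -/
theorem IsDefFun.exists_differentiableAt (hΩ : IsPresharp Ω) (hf : IsDefFun Ω f) (i : ι)
    {U : Set (ι → ℝ)} (hU : IsOpen U) (hne : U.Nonempty) :
    ∃ x ∈ U, DifferentiableAt ℝ (fun t => f (Function.update x i t)) (x i) := by
  have hle : IsDef Ω fun z : ι ⊕ Unit → ℝ =>
      f (fun j => z (Sum.inl j)) ≤ f (Function.update (fun j => z (Sum.inl j)) i (z (Sum.inr ()))) := by
    have h1 := IsDefFun.app hΩ hf (Sum.inl : ι → ι ⊕ Unit)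
      (fun z a => a ≤ f fun j => z (if j = i then Sum.inr () else Sum.inl j)) ?_
    · refine h1.congr fun _ z => ?_
      have : (Function.update (fun j => z (Sum.inl j)) i (z (Sum.inr ())))
          = fun j => z (if j = i then Sum.inr () else Sum.inl j) := by
        funext j
        by_cases hj : j = i
        · subst hj; simp
        · simp [hj]
      rw [this]
    · exact IsDefFun.app hΩ hf (fun j => Sum.inl (if j = i then Sum.inr () else Sum.inl j))
        (fun z b => z (Sum.inr ()) ≤ b)
        (.poly_le hΩ (.const _) (.coord fun _ => Sum.inl (Sum.inr ())) (.coord fun _ => Sum.inr ()))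
  have hA : ∀ k : ℕ × Bool, IsDef Ω fun x : ι → ℝ => ∀ t : ℝ, x i < t → t < x i + 1 / (k.1 + 1) →
      (f x ≤ f (Function.update x i t) ↔ k.2 = true) := by
    intro k
    refine Sharp.all_real hΩ ?_
    refine .imp hΩ (.poly_lt hΩ (.const _) (.coord fun _ => Sum.inl i)
      (.coord fun _ => Sum.inr ())) ?_
    refine .imp hΩ (.poly_lt hΩ (.const _) (.coord fun _ => Sum.inr ())
      (.add (.coord fun _ => Sum.inl i) (.const _))) ?_
    cases hb : k.2
    · simpa using hle.not hΩ
    · simpa using hle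
  obtain ⟨⟨n, b⟩, V, hVU, hVo, ⟨x, hx⟩, hV⟩ := IsDef.exists_open_of_cover hΩ hA hU hne
    fun x _ => by
      have hline := hle.line hΩ (g := fun j z => Sum.elim x (fun _ => z 0) j) fun j => by
        rcases j with j | j
        · exact PolyFamily.const (x j)
        · exact PolyFamily.coord fun _ => (0 : Fin 1)
      obtain ⟨n, hn | hn⟩ := hline.exists_Ioo (x i)
      · exact ⟨(n, true), fun t h1 h2 => by simpa using hn ⟨h1, h2⟩⟩
      · exact ⟨(n, false), fun t h1 h2 => by simpa using hn ⟨h1, h2⟩⟩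
  obtain ⟨ε, hε, hball⟩ := Metric.isOpen_iff.1 hVo x hx
  have hn : (0 : ℝ) < 1 / (n + 1) := by positivity
  set η := min ε (1 / (n + 1) / 2) with hη
  have hη0 : 0 < η := lt_min hε (by linarith)
  have hη1 : η ≤ ε := min_le_left _ _
  have hη2 : 2 * η ≤ 1 / (n + 1) := by have := min_le_right ε (1 / ((n : ℝ) + 1) / 2); linarith
  set J := Ioo (x i - η) (x i + η) with hJ
  set g : ℝ → ℝ := fun t => f (Function.update x i t) with hg
  have hmem : ∀ t ∈ J, Function.update x i t ∈ V := by
    intro t ht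
    refine hball ?_
    rw [Metric.mem_ball, dist_pi_lt_iff hε]
    intro j
    by_cases hj : j = i
    · subst hj
      rw [Function.update_self, Real.dist_eq, abs_lt]
      constructor <;> linarith [ht.1, ht.2]
    · simpa [hj] using hε
  have hcmp : ∀ s ∈ J, ∀ t ∈ J, s < t → (g s ≤ g t ↔ b = true) := by
    intro s hs t ht hst
    have := hV _ (hmem s hs) t (by simpa using hst)
      (by simp only [Function.update_self]; linarith [hs.1, ht.2])
    simpa using this
  have hae : ∀ᵐ t, t ∈ J → DifferentiableWithinAt ℝ g J t := by
    cases b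
    · have hanti : AntitoneOn g J := by
        intro s hs t ht hst
        rcases hst.eq_or_lt with rfl | hst
        · exact le_rfl
        · exact (not_le.1 (by simpa using hcmp s hs t ht hst)).le
      have := hanti.neg.ae_differentiableWithinAt_of_mem
      filter_upwards [this] with t ht htJ
      simpa using (ht htJ).neg
    · have hmono : MonotoneOn g J := by
        intro s hs t ht hst
        rcases hst.eq_or_lt with rfl | hst
        · exact le_rfl
        · simpa using hcmp s hs t ht hst
      exact hmono.ae_differentiableWithinAt_of_mem
  have hpos : MeasureTheory.volume J ≠ 0 := by
    rw [hJ, Real.volume_Ioo]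
    simpa using by linarith
  obtain ⟨t, htJ, ht⟩ : ∃ t ∈ J, DifferentiableWithinAt ℝ g J t := by
    by_contra! hcon
    refine hpos (MeasureTheory.measure_mono_null (fun t ht => ?_) hae)
    exact fun h => hcon t ht (h ht)
  refine ⟨Function.update x i t, hVU (hmem t htJ), ?_⟩
  have := ht.differentiableAt (isOpen_Ioo.mem_nhds htJ)
  simpa using this

theorem IsDefFun.exists_open_differentiableAt (hΩ : IsPresharp Ω) (hf : IsDefFun Ω f) (i : ι)
    {U : Set (ι → ℝ)} (hU : IsOpen U) (hne : U.Nonempty) :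
    ∃ V ⊆ U, IsOpen V ∧ V.Nonempty ∧ ∀ x ∈ V,
      DifferentiableAt ℝ (fun t => f (Function.update x i t)) (x i) := by
  obtain ⟨V, hVU, hVo, hVne, hV | hV⟩ :=
    (hf.differentiableAt hΩ i).genericallyConstant hΩ U hU hne
  · exact ⟨V, hVU, hVo, hVne, hV⟩
  · obtain ⟨x, hx, hd⟩ := hf.exists_differentiableAt hΩ i hVo hVne
    exact absurd hd (hV x hx)

/-! ### Uniform Taylor expansions -/

section BoxPoly

variable {ι : Type} [Fintype ι]

/-- The monomial function with exponents `α`. -/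
def boxMonomial {N : ℕ} (α : ι → Fin N) (h : ι → ℝ) : ℝ := ∏ i, h i ^ (α i : ℕ)

variable (ι) in
/-- The space of polynomial functions of degree less than `N` in each variable. -/
noncomputable def boxPoly (N : ℕ) : Submodule ℝ ((ι → ℝ) → ℝ) :=
  Submodule.span ℝ (range fun α : ι → Fin N => boxMonomial α)

theorem const_mem_boxPoly (N : ℕ) (a : ℝ) : (fun _ => a) ∈ boxPoly ι (N + 1) := by
  have : (fun _ : ι → ℝ => a) = a • boxMonomial fun _ : ι => (0 : Fin (N + 1)) := by
    funext h; simp [boxMonomial]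
  rw [this]
  exact Submodule.smul_mem _ _ (Submodule.subset_span ⟨_, rfl⟩)

variable [DecidableEq ι]

theorem mem_boxPoly_iff {N : ℕ} {P : (ι → ℝ) → ℝ} : P ∈ boxPoly ι N ↔
    ∃ c : (ι → Fin N) → ℝ, ∀ h, P h = ∑ α, c α * boxMonomial α h := by
  rw [boxPoly, Submodule.mem_span_range_iff_exists_fun]
  refine exists_congr fun c => ?_
  rw [funext_iff]
  simp [eq_comm]

theorem differentiable_of_mem_boxPoly {N : ℕ} {P : (ι → ℝ) → ℝ} (hP : P ∈ boxPoly ι N) :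
    Differentiable ℝ P := by
  obtain ⟨c, hc⟩ := mem_boxPoly_iff.1 hP
  rw [funext hc]
  unfold boxMonomial
  fun_prop

theorem boxMonomial_eq {N : ℕ} (α : ι → Fin N) (h : ι → ℝ) (i : ι) :
    boxMonomial α h = h i ^ (α i : ℕ) * ∏ j ∈ Finset.univ.erase i, h j ^ (α j : ℕ) :=
  (Finset.mul_prod_erase _ _ (Finset.mem_univ i)).symm

theorem comp_update_zero_mem_boxPoly {N : ℕ} {P : (ι → ℝ) → ℝ} (hP : P ∈ boxPoly ι N) (i : ι) :
    (fun h => P (Function.update h i 0)) ∈ boxPoly ι N := by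
  refine Submodule.span_induction (p := fun P _ =>
    (fun h => P (Function.update h i 0)) ∈ boxPoly ι N) ?_ (Submodule.zero_mem _)
    (fun P Q _ _ hP hQ => Submodule.add_mem _ hP hQ)
    (fun a P _ hP => Submodule.smul_mem _ a hP) hP
  rintro _ ⟨α, rfl⟩
  have h0 : ∀ h : ι → ℝ, boxMonomial α (Function.update h i 0)
      = 0 ^ (α i : ℕ) * ∏ j ∈ Finset.univ.erase i, h j ^ (α j : ℕ) := by
    intro h
    rw [boxMonomial_eq _ _ i, Function.update_self]
    congr 1
    refine Finset.prod_congr rfl fun j hj => ?_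
    rw [Function.update_of_ne (Finset.ne_of_mem_erase hj)]
  simp only [h0]
  by_cases hα : (α i : ℕ) = 0
  · refine Submodule.subset_span ⟨α, ?_⟩
    funext h
    simp [boxMonomial_eq α h i, hα]
  · simp only [zero_pow hα, zero_mul]
    exact Submodule.zero_mem _

/-- The antiderivative in the `i`-th variable that vanishes where that variable does. -/
theorem exists_antideriv_boxPoly {N : ℕ} {P : (ι → ℝ) → ℝ} (hP : P ∈ boxPoly ι N) (i : ι) :
    ∃ Q ∈ boxPoly ι (N + 1), (∀ h, Q (Function.update h i 0) = 0) ∧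
      ∀ h t, HasDerivAt (fun t => Q (Function.update h i t)) (P (Function.update h i t)) t := by
  refine Submodule.span_induction (p := fun P _ => ∃ Q ∈ boxPoly ι (N + 1),
    (∀ h, Q (Function.update h i 0) = 0) ∧
      ∀ h t, HasDerivAt (fun t => Q (Function.update h i t)) (P (Function.update h i t)) t)
    ?_ ?_ ?_ ?_ hP
  · rintro _ ⟨α, rfl⟩
    set β : ι → Fin (N + 1) := Function.update (fun j => (α j).castSucc) i (α i).succ
    have hβ : ∀ (h : ι → ℝ) (t : ℝ), boxMonomial β (Function.update h i t)
        = t ^ ((α i : ℕ) + 1) * ∏ j ∈ Finset.univ.erase i, h j ^ (α j : ℕ) := by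
      intro h t
      rw [boxMonomial_eq _ _ i, Function.update_self]
      congr 1
      · simp [β]
      · refine Finset.prod_congr rfl fun j hj => ?_
        rw [Function.update_of_ne (Finset.ne_of_mem_erase hj)]
        simp [β, Function.update_of_ne (Finset.ne_of_mem_erase hj)]
    refine ⟨((α i : ℝ) + 1)⁻¹ • boxMonomial β,
      Submodule.smul_mem _ _ (Submodule.subset_span ⟨β, rfl⟩), fun h => ?_, fun h t => ?_⟩
    · simp [hβ]
    · have h1 : ∀ t, boxMonomial α (Function.update h i t)
          = t ^ (α i : ℕ) * ∏ j ∈ Finset.univ.erase i, h j ^ (α j : ℕ) := by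
        intro t
        rw [boxMonomial_eq _ _ i, Function.update_self]
        congr 1
        refine Finset.prod_congr rfl fun j hj => ?_
        rw [Function.update_of_ne (Finset.ne_of_mem_erase hj)]
      simp only [Pi.smul_apply, hβ, h1, smul_eq_mul]
      have h2 := (((hasDerivAt_pow ((α i : ℕ) + 1) t).mul_const
        (∏ j ∈ Finset.univ.erase i, h j ^ (α j : ℕ))).const_mul ((α i : ℝ) + 1)⁻¹)
      refine h2.congr_deriv ?_
      have : ((α i : ℝ) + 1) ≠ 0 := by positivity
      rw [Nat.add_sub_cancel]
      push_cast
      field_simp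
  · exact ⟨0, Submodule.zero_mem _, fun _ => rfl, fun h t => hasDerivAt_const t 0⟩
  · rintro P Q - - ⟨P', hP', h1, h2⟩ ⟨Q', hQ', h3, h4⟩
    exact ⟨P' + Q', Submodule.add_mem _ hP' hQ', fun h => by simp [h1, h3],
      fun h t => (h2 h t).add (h4 h t)⟩
  · rintro a P - ⟨P', hP', h1, h2⟩
    exact ⟨a • P', Submodule.smul_mem _ _ hP', fun h => by simp [h1],
      fun h t => (h2 h t).const_mul a⟩

theorem degree_C_mul_le (a : ℝ) (p : Polynomial ℝ) : (Polynomial.C a * p).degree ≤ p.degree := by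
  rw [← Polynomial.smul_eq_C_mul]
  exact Polynomial.degree_smul_le a p

/-- On lines parallel to a coordinate axis, the functions in `boxPoly` are polynomials in one variable
whose derivative is again in `boxPoly`. -/
theorem exists_deriv_boxPoly {N : ℕ} {P : (ι → ℝ) → ℝ} (hP : P ∈ boxPoly ι N) (i : ι) :
    ∃ Q ∈ boxPoly ι N, ∀ h, ∃ p : Polynomial ℝ, p.degree < N ∧
      (∀ t, P (h + Pi.single i t) = p.eval t) ∧ Q h = p.derivative.eval 0 := by
  refine Submodule.span_induction (p := fun P _ => ∃ Q ∈ boxPoly ι N, ∀ h, ∃ p : Polynomial ℝ,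
    p.degree < N ∧ (∀ t, P (h + Pi.single i t) = p.eval t) ∧ Q h = p.derivative.eval 0)
    ?_ ?_ ?_ ?_ hP
  · rintro _ ⟨α, rfl⟩
    set β : ι → Fin N := Function.update α i ⟨α i - 1, by omega⟩
    refine ⟨(α i : ℝ) • boxMonomial β,
      Submodule.smul_mem _ _ (Submodule.subset_span ⟨β, rfl⟩), fun h => ?_⟩
    refine ⟨Polynomial.C (∏ j ∈ Finset.univ.erase i, h j ^ (α j : ℕ)) *
      (Polynomial.X + Polynomial.C (h i)) ^ (α i : ℕ), ?_, fun t => ?_, ?_⟩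
    · refine (degree_C_mul_le _ _).trans_lt ?_
      rw [Polynomial.degree_pow, Polynomial.degree_X_add_C]
      simp
    · change boxMonomial α _ = _
      rw [boxMonomial_eq _ _ i]
      simp only [Pi.add_apply, Pi.single_eq_same, Polynomial.eval_mul, Polynomial.eval_C,
        Polynomial.eval_pow, Polynomial.eval_add, Polynomial.eval_X]
      rw [mul_comm, add_comm t]
      congr 1
      refine Finset.prod_congr rfl fun j hj => ?_
      simp [Finset.ne_of_mem_erase hj]
    · rw [Pi.smul_apply, boxMonomial_eq _ _ i]
      have : ∏ j ∈ Finset.univ.erase i, h j ^ (β j : ℕ)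
          = ∏ j ∈ Finset.univ.erase i, h j ^ (α j : ℕ) :=
        Finset.prod_congr rfl fun j hj => by simp [β, Finset.ne_of_mem_erase hj]
      rw [this]
      generalize ∏ j ∈ Finset.univ.erase i, h j ^ (α j : ℕ) = c
      simp [β, Polynomial.derivative_X_add_C_pow]
      ring
  · exact ⟨0, Submodule.zero_mem _, fun h => ⟨0, by simp, by simp, by simp⟩⟩
  · rintro P Q - - ⟨P', hP', h1⟩ ⟨Q', hQ', h2⟩
    refine ⟨P' + Q', Submodule.add_mem _ hP' hQ', fun h => ?_⟩
    obtain ⟨p, hp, hp1, hp2⟩ := h1 h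
    obtain ⟨q, hq, hq1, hq2⟩ := h2 h
    exact ⟨p + q, (Polynomial.degree_add_le _ _).trans_lt (max_lt hp hq), by simp [hp1, hq1],
      by simp [hp2, hq2]⟩
  · rintro a P - ⟨P', hP', h1⟩
    refine ⟨a • P', Submodule.smul_mem _ _ hP', fun h => ?_⟩
    obtain ⟨p, hp, hp1, hp2⟩ := h1 h
    exact ⟨Polynomial.C a * p, (degree_C_mul_le _ _).trans_lt hp, by simp [hp1],
      by simp [hp2]⟩

end BoxPoly

/-- A bound for the derivative of a polynomial at `0` by its maximum on `[0, ρ]`, from Lagrange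
interpolation at `N` equidistant nodes. -/
theorem exists_derivative_bound (N : ℕ) : ∃ C : ℝ, 0 ≤ C ∧ ∀ p : Polynomial ℝ, p.degree < N →
    ∀ ρ K : ℝ, 0 < ρ → (∀ t ∈ Icc 0 ρ, |p.eval t| ≤ K) → ρ * |p.derivative.eval 0| ≤ C * K := by
  set v : ℕ → ℝ := fun k => k / N
  set b : ℕ → Polynomial ℝ := Lagrange.basis (Finset.range N) v
  refine ⟨∑ k ∈ Finset.range N, |(b k).derivative.eval 0|,
    Finset.sum_nonneg fun _ _ => abs_nonneg _, fun p hp ρ K hρ hK => ?_⟩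
  have hvs : Set.InjOn v (Finset.range N) := by
    intro j hj k hk hjk
    have hN : (N : ℝ) ≠ 0 := by
      have := Finset.mem_range.1 hj
      exact_mod_cast (by omega : N ≠ 0)
    simpa [v, div_left_inj' hN] using hjk
  set q : Polynomial ℝ := p.comp (Polynomial.C ρ * Polynomial.X)
  have hq : q.degree < (Finset.range N).card := by
    rw [Finset.card_range]
    have h1 : q.natDegree ≤ p.natDegree := by
      refine (Polynomial.natDegree_comp_le).trans ?_
      rw [Polynomial.natDegree_C_mul_X ρ hρ.ne', mul_one]
    rcases eq_or_ne p 0 with rfl | hp0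
    · simp [q] at hp ⊢
    · refine (Polynomial.degree_le_natDegree).trans_lt ?_
      rw [Polynomial.degree_eq_natDegree hp0] at hp
      exact lt_of_le_of_lt (by exact_mod_cast h1) hp
  have hint := Lagrange.eq_interpolate hvs hq
  have hder : q.derivative.eval 0 = ρ * p.derivative.eval 0 := by
    simp [q, Polynomial.derivative_comp]
  rw [show ρ * |p.derivative.eval 0| = |q.derivative.eval 0| by rw [hder, abs_mul, abs_of_pos hρ],
    hint, Lagrange.interpolate_apply,
    Polynomial.derivative_sum, Polynomial.eval_finsetSum, Finset.sum_mul]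
  refine (Finset.abs_sum_le_sum_abs _ _).trans (Finset.sum_le_sum fun k hk => ?_)
  rw [Polynomial.derivative_C_mul, Polynomial.eval_mul, Polynomial.eval_C, abs_mul, mul_comm]
  refine mul_le_mul_of_nonneg_left ?_ (abs_nonneg _)
  have hkN : (k : ℝ) / N ≤ 1 := by
    have := Finset.mem_range.1 hk
    exact div_le_one_of_le₀ (by exact_mod_cast this.le) (by positivity)
  have hk0 : (0 : ℝ) ≤ (k : ℝ) / N := by positivity
  have := hK (ρ * v k) ⟨by positivity, by simp only [v]; nlinarith⟩
  simpa [q] using this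

theorem exists_ball_of_isOpen {X : Type*} [PseudoMetricSpace X] {U : Set X} (hU : IsOpen U)
    (hne : U.Nonempty) : ∃ x, ∃ ρ > 0, Metric.ball x ρ ⊆ U := by
  obtain ⟨x, hx⟩ := hne
  obtain ⟨ρ, hρ, h⟩ := Metric.isOpen_iff.1 hU x hx
  exact ⟨x, ρ, hρ, h⟩

/-- Finitely many properties that hold generically hold simultaneously on an open subset. -/
theorem exists_open_forall {K : Type*} (s : Finset K) {X : Type*} [TopologicalSpace X]
    {p : K → Set X → Prop}
    (hp : ∀ k U V, V ⊆ U → p k U → p k V)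
    (hex : ∀ k U, IsOpen U → U.Nonempty → ∃ V ⊆ U, IsOpen V ∧ V.Nonempty ∧ p k V)
    {U : Set X} (hU : IsOpen U) (hne : U.Nonempty) :
    ∃ V ⊆ U, IsOpen V ∧ V.Nonempty ∧ ∀ k ∈ s, p k V := by
  classical
  induction s using Finset.induction_on with
  | empty => exact ⟨U, subset_rfl, hU, hne, by simp⟩
  | insert a s _ ih =>
    obtain ⟨V, hVU, hVo, hVne, hV⟩ := ih
    obtain ⟨W, hWV, hWo, hWne, hW⟩ := hex a V hVo hVne
    refine ⟨W, hWV.trans hVU, hWo, hWne, fun k hk => ?_⟩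
    rcases Finset.mem_insert.1 hk with rfl | hk
    · exact hW
    · exact hp k _ _ hWV (hV k hk)

variable {ι : Type} [Fintype ι]

/-- `f` has at the points of `U` expansions in polynomials of degree less than `N` in each variable,
with a remainder of order `n` that is uniform over `U`. -/
def TaylorOn (N n : ℕ) (f : (ι → ℝ) → ℝ) (U : Set (ι → ℝ)) : Prop :=
  ∃ M : ℝ, ∀ x ∈ U, ∃ P ∈ boxPoly ι N, ∀ y ∈ U, |f y - P (y - x)| ≤ M * ‖y - x‖ ^ n

theorem TaylorOn.mono {N n : ℕ} {f : (ι → ℝ) → ℝ} {U V : Set (ι → ℝ)} (h : TaylorOn N n f U)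
    (hVU : V ⊆ U) : TaylorOn N n f V := by
  obtain ⟨M, hM⟩ := h
  refine ⟨M, fun x hx => ?_⟩
  obtain ⟨P, hP, h⟩ := hM x (hVU hx)
  exact ⟨P, hP, fun y hy => h y (hVU hy)⟩

variable [DecidableEq ι]

/-- Integrating the expansions of the partial derivatives along a path parallel to the coordinate
axes gives expansions of the function. -/
theorem TaylorOn.of_partialDeriv {N n : ℕ} {f : (ι → ℝ) → ℝ} {x₀ : ι → ℝ} {ρ : ℝ}
    (hd : ∀ x ∈ Metric.ball x₀ ρ, ∀ i,
      DifferentiableAt ℝ (fun t => f (Function.update x i t)) (x i))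
    (hT : ∀ i, TaylorOn N n (partialDeriv f i) (Metric.ball x₀ ρ)) :
    TaylorOn (N + 1) (n + 1) f (Metric.ball x₀ ρ) := by
  set B := Metric.ball x₀ ρ with hB
  have hcoord : ∀ x ∈ B, ∀ y ∈ B, ∀ i, ∀ t ∈ uIcc (x i) (y i), Function.update y i t ∈ B := by
    intro x hx y hy i t ht
    have hρ : 0 < ρ := dist_nonneg.trans_lt hx
    rw [hB, Metric.mem_ball, dist_pi_lt_iff hρ] at hx hy ⊢
    intro j
    by_cases hj : j = i
    · subst hj
      rw [Function.update_self]
      exact (convex_ball (x₀ j) ρ).ordConnected.uIcc_subset (hx j) (hy j) ht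
    · simpa [hj] using hy j
  suffices key : ∀ s : Finset ι, ∃ M : ℝ, 0 ≤ M ∧ ∀ x ∈ B, ∃ P ∈ boxPoly ι (N + 1), ∀ y ∈ B,
      (∀ j ∉ s, y j = x j) → |f y - P (y - x)| ≤ M * ‖y - x‖ ^ (n + 1) by
    obtain ⟨M, -, hM⟩ := key Finset.univ
    refine ⟨M, fun x hx => ?_⟩
    obtain ⟨P, hP, h⟩ := hM x hx
    exact ⟨P, hP, fun y hy => h y hy (by simp)⟩
  intro s
  induction s using Finset.induction_on with
  | empty =>
    refine ⟨0, le_rfl, fun x _ => ⟨fun _ => f x, const_mem_boxPoly N _, fun y _ hyx => ?_⟩⟩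
    obtain rfl : y = x := funext fun j => hyx j (by simp)
    simp
  | insert i s hi ih =>
    obtain ⟨M, hM0, hM⟩ := ih
    obtain ⟨M', hM'⟩ := hT i
    refine ⟨M + |M'|, by positivity, fun x hx => ?_⟩
    obtain ⟨P, hP, hPf⟩ := hM x hx
    obtain ⟨Q, hQ, hQf⟩ := hM' x hx
    obtain ⟨R, hR, hR0, hRd⟩ := exists_antideriv_boxPoly hQ i
    refine ⟨(fun h => P (Function.update h i 0)) + R,
      Submodule.add_mem _ (comp_update_zero_mem_boxPoly hP i) hR, fun y hy hyx => ?_⟩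
    set y' := Function.update y i (x i) with hy'
    have hy'B : y' ∈ B := hcoord x hx y hy i _ left_mem_uIcc
    have hsub : ∀ t, Function.update y i t - x = Function.update (y - x) i (t - x i) := by
      intro t
      funext j
      by_cases hj : j = i
      · subst hj; simp
      · simp [hj]
    have hnorm : ∀ t ∈ uIcc (x i) (y i), ‖Function.update y i t - x‖ ≤ ‖y - x‖ := by
      intro t ht
      refine (pi_norm_le_iff_of_nonneg (norm_nonneg _)).2 fun j => ?_
      by_cases hj : j = i
      · subst hj
        have h1 : ‖(y - x) j‖ ≤ ‖y - x‖ := norm_le_pi_norm _ j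
        refine le_trans ?_ h1
        simpa [Real.norm_eq_abs] using abs_sub_left_of_mem_uIcc ht
      · simpa [hj] using norm_le_pi_norm (y - x) j
    have h1 : |f y' - P (y' - x)| ≤ M * ‖y - x‖ ^ (n + 1) := by
      refine (hPf y' hy'B fun j hj => ?_).trans ?_
      · by_cases hji : j = i
        · subst hji; simp [y']
        · simpa [y', hji] using hyx j (by simp [hj, hji])
      · gcongr
        exact hnorm _ left_mem_uIcc
    have hder : ∀ t ∈ uIcc (x i) (y i), HasDerivWithinAt
        (fun t => f (Function.update y i t) - R (Function.update (y - x) i (t - x i)))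
        (partialDeriv f i (Function.update y i t) - Q (Function.update y i t - x))
        (uIcc (x i) (y i)) t := by
      intro t ht
      refine (HasDerivAt.sub ?_ ?_).hasDerivWithinAt
      · have := (hd _ (hcoord x hx y hy i t ht) i).hasDerivAt
        simpa [partialDeriv] using this
      · have := (hRd (y - x) (t - x i)).comp_sub_const t (x i)
        rwa [← hsub] at this
    have h2 := Convex.norm_image_sub_le_of_norm_hasDerivWithin_le hder
      (C := |M'| * ‖y - x‖ ^ n) (fun t ht => by
        refine (hQf _ (hcoord x hx y hy i t ht)).trans ?_
        gcongr
        · exact le_abs_self M'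
        · exact hnorm t ht) (convex_uIcc _ _) left_mem_uIcc right_mem_uIcc
    simp only [← hsub, Function.update_eq_self] at h2
    have hz : R (Function.update y i (x i) - x) = 0 := by rw [hsub, sub_self]; exact hR0 _
    rw [hz, sub_zero, Real.norm_eq_abs] at h2
    have h3 : |M'| * ‖y - x‖ ^ n * ‖y i - x i‖ ≤ |M'| * ‖y - x‖ ^ (n + 1) := by
      rw [pow_succ, ← mul_assoc]
      gcongr
      exact norm_le_pi_norm (y - x) i
    have h4 : Function.update (y - x) i 0 = y' - x := by rw [hy', hsub, sub_self]
    simp only [Pi.add_apply, h4]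
    calc |f y - (P (y' - x) + R (y - x))|
        = |(f y - R (y - x) - f y') + (f y' - P (y' - x))| := by ring_nf
      _ ≤ |f y - R (y - x) - f y'| + |f y' - P (y' - x)| := abs_add_le _ _
      _ ≤ (M + |M'|) * ‖y - x‖ ^ (n + 1) := by rw [add_mul]; linarith

variable {S : OMinimalExpansion} {Ω : FDFiltration S}

/-- Definable functions have uniform Taylor expansions of any order on some open subset. -/
theorem IsDefFun.exists_open_taylorOn (hΩ : IsPresharp Ω) (n : ℕ) {f : (ι → ℝ) → ℝ}
    (hf : IsDefFun Ω f) {U : Set (ι → ℝ)} (hU : IsOpen U) (hne : U.Nonempty) :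
    ∃ V ⊆ U, IsOpen V ∧ V.Nonempty ∧ TaylorOn (n + 1) n f V := by
  induction n generalizing f U with
  | zero =>
    obtain ⟨M, V, hVU, hVo, hVne, hV⟩ := hf.exists_open_bounded hΩ hU hne
    exact ⟨V, hVU, hVo, hVne, M, fun x _ => ⟨0, Submodule.zero_mem _, fun y hy => by
      simpa using hV y hy⟩⟩
  | succ n ih =>
    obtain ⟨V, hVU, hVo, hVne, hV⟩ := exists_open_forall Finset.univ
      (p := fun i V => ∀ x ∈ V, DifferentiableAt ℝ (fun t => f (Function.update x i t)) (x i))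
      (fun i _ _ h hV x hx => hV x (h hx))
      (fun i U hU hne => hf.exists_open_differentiableAt hΩ i hU hne) hU hne
    obtain ⟨W, hWV, hWo, hWne, hW⟩ := exists_open_forall Finset.univ
      (p := fun i V => TaylorOn (n + 1) n (partialDeriv f i) V)
      (fun i _ _ h hV => hV.mono h)
      (fun i U hU hne => ih (hf.isDefFun_partialDeriv hΩ i) hU hne) hVo hVne
    obtain ⟨x, ρ, hρ, hB⟩ := exists_ball_of_isOpen hWo hWne
    exact ⟨Metric.ball x ρ, hB.trans (hWV.trans hVU), Metric.isOpen_ball,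
      ⟨x, Metric.mem_ball_self hρ⟩, TaylorOn.of_partialDeriv
      (fun y hy i => hV i (Finset.mem_univ i) y (hWV (hB hy)))
      (fun i => (hW i (Finset.mem_univ i)).mono hB)⟩

theorem hasFDerivAt_of_expansion {N n : ℕ} {f : (ι → ℝ) → ℝ} {U : Set (ι → ℝ)} (hU : IsOpen U)
    {M : ℝ} {x : ι → ℝ} (hx : x ∈ U) {P : (ι → ℝ) → ℝ} (hP : P ∈ boxPoly ι N)
    (h : ∀ y ∈ U, |f y - P (y - x)| ≤ M * ‖y - x‖ ^ (n + 2)) :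
    HasFDerivAt f (fderiv ℝ P 0) x := by
  have h0 : f x = P 0 := by
    have := h x hx
    simpa [sub_eq_zero] using this
  have hd : HasFDerivAt (fun y => P (y - x)) (fderiv ℝ P 0) x := by
    have h1 := ((differentiable_of_mem_boxPoly hP) 0).hasFDerivAt
    have h2 : HasFDerivAt (fun y => y - x) (ContinuousLinearMap.id ℝ (ι → ℝ)) x :=
      (hasFDerivAt_id x).sub_const x
    rw [← sub_self x] at h1 ⊢
    have h3 := HasFDerivAt.comp (f := fun y => y - x) x h1 h2
    rw [ContinuousLinearMap.comp_id] at h3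
    exact h3
  have hr : HasFDerivAt (fun y => f y - P (y - x)) (0 : (ι → ℝ) →L[ℝ] ℝ) x := by
    rw [hasFDerivAt_iff_isLittleO]
    have h1 : (fun y => f y - P (y - x)) =O[𝓝 x] fun y => ‖y - x‖ ^ (n + 2) := by
      refine Asymptotics.IsBigO.of_bound M ?_
      filter_upwards [hU.mem_nhds hx] with y hy
      simpa using h y hy
    have h2 : (fun y : ι → ℝ => ‖y - x‖ ^ (n + 2)) =o[𝓝 x] fun y => y - x :=
      Asymptotics.isLittleO_pow_sub_sub x (by omega)
    have := h1.trans_isLittleO h2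
    simpa [h0] using this
  have := hr.add hd
  rw [zero_add] at this
  exact this.congr_of_eventuallyEq (.of_forall fun y => by simp)

theorem hasDerivAt_add_single (i : ι) (x : ι → ℝ) (t : ℝ) :
    HasDerivAt (fun t : ℝ => x + Pi.single i t) (Pi.single i (1 : ℝ)) t := by
  refine HasDerivAt.const_add x (hasDerivAt_pi.2 fun j => ?_)
  by_cases hj : j = i
  · subst hj; simpa using hasDerivAt_id' t
  · simpa [hj] using hasDerivAt_const t (0 : ℝ)

/-- The difference of the expansions at two points is a polynomial that is small near these points,
hence so are the differences of their partial derivatives. -/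
theorem TaylorOn.fderiv_apply {N n : ℕ} {f : (ι → ℝ) → ℝ} {U : Set (ι → ℝ)}
    (h : TaylorOn N (n + 2) f U) (hU : IsOpen U) {x₀ : ι → ℝ} {η : ℝ} (hη : 0 < η)
    (hball : Metric.ball x₀ (3 * η) ⊆ U) (i : ι) :
    TaylorOn N (n + 1) (fun x => fderiv ℝ f x (Pi.single i 1)) (Metric.ball x₀ η) := by
  obtain ⟨M, hM⟩ := h
  choose! P hP hPf using hM
  have hsub : Metric.ball x₀ η ⊆ U := (Metric.ball_subset_ball (by linarith)).trans hball
  obtain ⟨C, hC0, hC⟩ := exists_derivative_bound N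
  have hM0 : ∀ x ∈ U, ∀ y ∈ U, |f y - P x (y - x)| ≤ |M| * ‖y - x‖ ^ (n + 2) := fun x hx y hy =>
    (hPf x hx y hy).trans (mul_le_mul_of_nonneg_right (le_abs_self M) (by positivity))
  refine ⟨C * (|M| + |M| * 2 ^ (n + 2)), fun x hx => ?_⟩
  obtain ⟨Q, hQ, hQp⟩ := exists_deriv_boxPoly (hP x (hsub hx)) i
  refine ⟨Q, hQ, fun y hy => ?_⟩
  change |fderiv ℝ f y (Pi.single i 1) - Q (y - x)| ≤ _
  obtain ⟨p, hp, hp1, hp2⟩ := hQp (y - x)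
  obtain ⟨Q', -, hQp'⟩ := exists_deriv_boxPoly (hP y (hsub hy)) i
  obtain ⟨q, hq, hq1, -⟩ := hQp' 0
  have hay : fderiv ℝ f y (Pi.single i 1) = q.derivative.eval 0 := by
    have h1 : HasDerivAt (fun t => P y (0 + Pi.single i t))
        (fderiv ℝ (P y) 0 (Pi.single i 1)) 0 := by
      have h0 : HasFDerivAt (P y) (fderiv ℝ (P y) 0) ((0 : ι → ℝ) + Pi.single i 0) := by
        simpa using ((differentiable_of_mem_boxPoly (hP y (hsub hy))) 0).hasFDerivAt
      exact h0.comp_hasDerivAt 0 (hasDerivAt_add_single i 0 0)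
    simp only [hq1] at h1
    rw [(hasFDerivAt_of_expansion hU (hsub hy) (hP y (hsub hy)) (hPf y (hsub hy))).fderiv]
    exact h1.unique (q.hasDerivAt 0)
  rcases eq_or_ne y x with rfl | hyx
  · -- At the centre both sides are the derivative of the same polynomial.
    have : p = q := Polynomial.funext fun t => by rw [← hp1, ← hq1, sub_self]
    rw [hay, hp2, this]
    simp
  have hρ : 0 < ‖y - x‖ := norm_pos_iff.2 (sub_ne_zero.2 hyx)
  have hρη : ‖y - x‖ < 2 * η := by
    have h1 : dist y x ≤ dist y x₀ + dist x₀ x := dist_triangle _ _ _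
    have h2 := Metric.mem_ball.1 hx
    have h3 := Metric.mem_ball.1 hy
    rw [dist_comm] at h2
    rw [← dist_eq_norm]
    linarith
  generalize hρ' : ‖y - x‖ = ρ at hρ hρη ⊢
  have hb := hC (q - p) ((Polynomial.degree_sub_le _ _).trans_lt (max_lt hq hp)) ρ
    ((|M| + |M| * 2 ^ (n + 2)) * ρ ^ (n + 2)) hρ fun t ht => ?_
  · rw [Polynomial.derivative_sub, Polynomial.eval_sub, ← hay, ← hp2] at hb
    refine le_of_mul_le_mul_left (hb.trans (le_of_eq ?_)) hρ
    rw [pow_succ ρ (n + 1)]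
    ring
  · have ht' : ‖(Pi.single i t : ι → ℝ)‖ = t := by
      rw [Pi.norm_single, Real.norm_eq_abs, abs_of_nonneg ht.1]
    have hyt : y + Pi.single i t ∈ U := by
      refine hball ?_
      rw [Metric.mem_ball, dist_eq_norm]
      have h3 := Metric.mem_ball.1 hy
      rw [dist_eq_norm] at h3
      have h4 := norm_add_le (y - x₀) (Pi.single i t : ι → ℝ)
      rw [ht'] at h4
      rw [add_sub_right_comm]
      linarith [ht.2]
    have h1 := hM0 y (hsub hy) _ hyt
    have h2 := hM0 x (hsub hx) _ hyt
    rw [add_sub_cancel_left, ← zero_add (Pi.single i t : ι → ℝ), hq1, zero_add, ht'] at h1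
    rw [add_sub_right_comm, hp1] at h2
    have h3 : ‖y - x + Pi.single i t‖ ≤ 2 * ρ := by
      have h4 := norm_add_le (y - x) (Pi.single i t : ι → ℝ)
      rw [ht', hρ'] at h4
      linarith [ht.2]
    have h4 : |M| * t ^ (n + 2) ≤ |M| * ρ ^ (n + 2) :=
      mul_le_mul_of_nonneg_left (pow_le_pow_left₀ ht.1 ht.2 _) (abs_nonneg M)
    have h5 : |M| * ‖y - x + Pi.single i t‖ ^ (n + 2) ≤ |M| * (2 * ρ) ^ (n + 2) :=
      mul_le_mul_of_nonneg_left (pow_le_pow_left₀ (norm_nonneg _) h3 _) (abs_nonneg M)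
    rw [mul_pow] at h5
    rw [Polynomial.eval_sub]
    generalize f (y + Pi.single i t) = v at h1 h2
    have h6 : |q.eval t - p.eval t| ≤ |v - p.eval t| + |v - q.eval t| := by
      rw [show q.eval t - p.eval t = (v - p.eval t) - (v - q.eval t) by ring]
      exact abs_sub _ _
    rw [add_mul, mul_assoc |M|]
    linarith

/-- The converse of Taylor's theorem. -/
theorem TaylorOn.contDiffAt {N n : ℕ} {f : (ι → ℝ) → ℝ} {U : Set (ι → ℝ)}
    (h : TaylorOn N (n + 1) f U) (hU : IsOpen U) {x₀ : ι → ℝ} (hx₀ : x₀ ∈ U) :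
    ContDiffAt ℝ n f x₀ := by
  induction n generalizing f U with
  | zero =>
    refine contDiffAt_zero.2 ⟨U, hU.mem_nhds hx₀, fun x hx => ?_⟩
    refine ContinuousAt.continuousWithinAt ?_
    obtain ⟨M, hM⟩ := h
    obtain ⟨P, hP, hPf⟩ := hM x hx
    have h0 : f x = P 0 := by
      have := hPf x hx
      simpa [sub_eq_zero] using this
    have h1 : Tendsto (fun y => P (y - x)) (𝓝 x) (𝓝 (f x)) := by
      have : Continuous fun y => P (y - x) :=
        (differentiable_of_mem_boxPoly hP).continuous.comp (continuous_id.sub continuous_const)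
      simpa [h0] using this.tendsto x
    have h2 : Tendsto (fun y => f y - P (y - x)) (𝓝 x) (𝓝 0) := by
      have hlim : Tendsto (fun y => M * ‖y - x‖ ^ (0 + 1)) (𝓝 x) (𝓝 0) := by
        have : Continuous fun y => M * ‖y - x‖ ^ (0 + 1) := by fun_prop
        simpa using this.tendsto x
      refine squeeze_zero_norm' ?_ hlim
      filter_upwards [hU.mem_nhds hx] with y hy using hPf y hy
    simpa [ContinuousAt] using h2.add h1
  | succ n ih =>
    obtain ⟨η, hη, hball⟩ : ∃ η > 0, Metric.ball x₀ (3 * η) ⊆ U := by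
      obtain ⟨ρ, hρ, h⟩ := Metric.isOpen_iff.1 hU x₀ hx₀
      exact ⟨ρ / 3, by positivity, by rwa [mul_div_cancel₀ _ (by norm_num)]⟩
    have hcont : ContDiffAt ℝ n (fun x => ∑ i, fderiv ℝ f x (Pi.single i 1) •
        (ContinuousLinearMap.proj i : (ι → ℝ) →L[ℝ] ℝ)) x₀ :=
      ContDiffAt.sum fun i _ => (ih (h.fderiv_apply hU hη hball i) Metric.isOpen_ball
        (Metric.mem_ball_self hη)).smul contDiffAt_const
    refine contDiffAt_succ_iff_hasFDerivAt.2 ⟨_, ⟨U, hU.mem_nhds hx₀, fun x hx => ?_⟩, hcont⟩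
    obtain ⟨M, hM⟩ := h
    obtain ⟨P, hP, hPf⟩ := hM x hx
    have h1 : (∑ i, fderiv ℝ f x (Pi.single i 1) •
        (ContinuousLinearMap.proj i : (ι → ℝ) →L[ℝ] ℝ)) = fderiv ℝ f x := by
      ext v
      have hv : v = ∑ i, v i • (Pi.single i 1 : ι → ℝ) := by
        funext j
        simp [Finset.sum_apply, Pi.single_apply]
      conv_rhs => rw [hv]
      simp [mul_comm]
    rw [h1]
    exact (hasFDerivAt_of_expansion hU hx hP hPf).differentiableAt.hasFDerivAt

/-! ### Regular points -/

section Regular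

variable {ℓ : ℕ}

/-- The square of the Euclidean distance between the projections to the coordinates in `s`. -/
def sqDistOn (s : Finset (Fin ℓ)) (x y : Fin ℓ → ℝ) : ℝ := ∑ i ∈ s, (x i - y i) ^ 2

/-- The projection to the coordinates in `s`. -/
def restr (s : Finset (Fin ℓ)) (x : Fin ℓ → ℝ) : s → ℝ := fun i => x i

/-- Near `p` the set `X` is the graph over an open set in the coordinates `s` of a map with uniform
Taylor expansions of order `r + 1`. The ball and the open set have a common centre `q`, which need not
be `p`, so the condition is open in `X`. The coefficients of the expansions are quantified variables:
the expansion is then a single polynomial inequality of degree linear in `r`. The degree bound `r + 3`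
is the one that holds for the expansions of order `r + 2` of definable functions. -/
def IsRegularPt (r : ℕ) (s : Finset (Fin ℓ)) (X : (Fin ℓ → ℝ) → Prop) (p : Fin ℓ → ℝ) : Prop :=
  X p ∧ ∃ q : Fin ℓ → ℝ, ∃ ε ε' : ℝ, sqDistOn Finset.univ p q < ε ∧ sqDistOn s p q < ε' ∧
    (∀ u : Fin ℓ → ℝ, sqDistOn s u q < ε' →
      ∃ x : Fin ℓ → ℝ, X x ∧ sqDistOn Finset.univ x q < ε ∧ sqDistOn s x u = 0) ∧
    ∀ y : Fin ℓ → ℝ, X y → sqDistOn Finset.univ y q < ε →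
      ∃ c : Fin ℓ × (s → Fin (r + 3)) → ℝ, ∀ x : Fin ℓ → ℝ, X x → sqDistOn Finset.univ x q < ε →
        ∑ j, (x j - ∑ α, c (j, α) * boxMonomial α fun i : s => x i - y i) ^ 2
          ≤ sqDistOn s x y ^ (r + 1)

variable {S : OMinimalExpansion} {Ω : FDFiltration S} {P : Type} {sc : Scale P}

theorem PolyFamily.sqDistOn {ι : P → Type} (s : Finset (Fin ℓ)) (a b : ∀ p, Fin ℓ → ι p) :
    PolyFamily fun p (z : ι p → ℝ) =>
      SharplyOMinimal.sqDistOn s (fun i => z (a p i)) (fun i => z (b p i)) :=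
  .sum fun i _ => ((PolyFamily.coord fun p => a p i).sub (.coord fun p => b p i)).pow 2

theorem isPolyOfDegreeLE_taylor {ι : Type} (r : ℕ) (s : Finset (Fin ℓ)) (a b : Fin ℓ → ι)
    (c : Fin ℓ × (s → Fin (r + 3)) → ι) :
    IsPolyOfDegreeLE (2 * (1 + ℓ * (r + 3)) + 2 * (r + 1)) fun z : ι → ℝ =>
      sqDistOn s (fun i => z (a i)) (fun i => z (b i)) ^ (r + 1) -
        ∑ j, (z (a j) - ∑ α, z (c (j, α)) * boxMonomial α fun i : s => z (a i) - z (b i)) ^ 2 := by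
  have hd : ∀ i, IsPolyOfDegreeLE 1 fun z : ι → ℝ => z (a i) - z (b i) := fun i =>
    ((IsPolyOfDegreeLE.coord _).sub (.coord _)).mono (by simp)
  have h1 : IsPolyOfDegreeLE 2 fun z : ι → ℝ => sqDistOn s (fun i => z (a i)) (fun i => z (b i)) :=
    .sum fun i _ => (hd i).pow 2
  have hs : s.card ≤ ℓ := by simpa using s.card_le_univ
  have h2 : ∀ α : s → Fin (r + 3), IsPolyOfDegreeLE (ℓ * (r + 3)) fun z : ι → ℝ =>
      boxMonomial α fun i : s => z (a i) - z (b i) := by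
    intro α
    refine (IsPolyOfDegreeLE.prod (n := r + 3)
      fun (i : s) _ => ((hd (i : Fin ℓ)).pow (α i : ℕ)).mono ?_).mono ?_
    · have := (α i).2
      omega
    · rw [Finset.card_univ, Fintype.card_coe]
      exact Nat.mul_le_mul_right _ hs
  refine ((h1.pow (r + 1)).sub (.sum (n := 2 * (1 + ℓ * (r + 3))) fun j _ => .pow (.mono (.sub
    (.coord _) (.sum (n := 1 + ℓ * (r + 3)) fun α _ => (IsPolyOfDegreeLE.coord _).mul (h2 α))) ?_)
    2)).mono ?_
  · simp
  · refine max_le ?_ ?_ <;> nlinarith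

/-- The regular points of the members of a sharp family form a sharp family. -/
theorem Sharp.isRegularPt (hΩ : IsPresharp Ω) {A : ∀ _ : P, (Fin ℓ → ℝ) → Prop}
    (hA : Sharp Ω sc A) (s : Finset (Fin ℓ)) :
    Sharp Ω sc fun p x => IsRegularPt (sc.r p) s (A p) x := by
  have hc : BddVars sc fun p => Fin ℓ × (s → Fin (sc.r p + 3)) :=
    ⟨fun _ r => ℓ * (r + 3) ^ s.card, fun p => by simp⟩
  refine .and hΩ hA (.ex hΩ (.ex_real hΩ (.ex_real hΩ (.and hΩ ?_ (.and hΩ ?_ (.and hΩ ?_ ?_))))))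
  · exact .poly_lt hΩ (.const _) (.sqDistOn _ _ _) (.coord _)
  · exact .poly_lt hΩ (.const _) (.sqDistOn _ _ _) (.coord _)
  · refine .all hΩ (.imp hΩ (.poly_lt hΩ (.const _) (.sqDistOn _ _ _) (.coord _)) ?_)
    refine .ex hΩ (.and hΩ (.subst hΩ hA (.const _) _) (.and hΩ ?_ ?_))
    · exact .poly_lt hΩ (.const _) (.sqDistOn _ _ _) (.coord _)
    · exact .poly_eq hΩ (.const _) (.sqDistOn _ _ _) (.const 0)
  · refine .all hΩ (.imp hΩ (.subst hΩ hA (.const _) _) (.imp hΩ ?_ ?_))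
    · exact .poly_lt hΩ (.const _) (.sqDistOn _ _ _) (.coord _)
    have hb : BddVars sc fun p => (((((Fin ℓ ⊕ Fin ℓ) ⊕ Unit) ⊕ Unit) ⊕ Fin ℓ) ⊕
        (Fin ℓ × (s → Fin (sc.r p + 3)))) ⊕ Fin ℓ := ((BddVars.const _).sum hc).sum (.const _)
    refine .ex (κ := fun p => Fin ℓ × (s → Fin (sc.r p + 3))) hΩ (.all hΩ (.imp hΩ
      (.subst hΩ hA hb _) (.imp hΩ (.poly_lt hΩ hb (.sqDistOn _ _ _) (.coord _)) ?_)))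
    have := Sharp.nonneg hΩ hb
      (2 * (1 + MvPolynomial.C ℓ * (MvPolynomial.X 1 + 3)) + 2 * (MvPolynomial.X 1 + 1))
      (f := fun p z => _) (fun p => (isPolyOfDegreeLE_taylor (sc.r p) s Sum.inr
        (fun i => Sum.inl (Sum.inl (Sum.inr i))) (fun k => Sum.inl (Sum.inr k))).mono
        (by simp [Scale.val]))
    exact this.congr fun p z => by rw [sub_nonneg]

theorem isOpen_sqDistOn_lt (s : Finset (Fin ℓ)) (q : Fin ℓ → ℝ) (ε : ℝ) :
    IsOpen {x | sqDistOn s x q < ε} := by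
  unfold sqDistOn
  exact isOpen_lt (by fun_prop) continuous_const

/-- Around a regular point, the points of `X` are those of a graph with uniform Taylor expansions, and
all of them are regular. -/
theorem IsRegularPt.exists_graph {r : ℕ} {s : Finset (Fin ℓ)} {X : (Fin ℓ → ℝ) → Prop}
    {p : Fin ℓ → ℝ} (h : IsRegularPt r s X p) :
    ∃ (V : Set (Fin ℓ → ℝ)) (W : Set (s → ℝ)) (f : (s → ℝ) → Fin ℓ → ℝ), IsOpen V ∧ IsOpen W ∧
      p ∈ V ∧ (∀ x ∈ V, restr s x ∈ W) ∧ (∀ x ∈ V, X x → IsRegularPt r s X x) ∧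
      (∀ u ∈ W, f u ∈ V ∧ X (f u) ∧ restr s (f u) = u) ∧
      (∀ x ∈ V, X x → f (restr s x) = x) ∧
      ∀ j, TaylorOn (r + 3) (r + 1) (fun u => f u j) W := by
  obtain ⟨hXp, q, ε, ε', hp, hp', h1, h2⟩ := h
  set W : Set (s → ℝ) := {u | ∑ i : s, (u i - q i) ^ 2 < ε'} with hW
  have hWr : ∀ x : Fin ℓ → ℝ, restr s x ∈ W ↔ sqDistOn s x q < ε' := by
    intro x
    rw [hW, mem_ofPred_eq, sqDistOn, ← Finset.sum_coe_sort s fun i => (x i - q i) ^ 2]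
    rfl
  have hdist : ∀ x y : Fin ℓ → ℝ, sqDistOn s x y = 0 ↔ restr s x = restr s y := by
    intro x y
    rw [sqDistOn, Finset.sum_eq_zero_iff_of_nonneg fun i _ => sq_nonneg _, funext_iff]
    simp [restr, sub_eq_zero]
  have hex : ∀ u ∈ W, ∃ x, X x ∧ sqDistOn Finset.univ x q < ε ∧ restr s x = u := by
    intro u hu
    let v : Fin ℓ → ℝ := fun i => if h : i ∈ s then u ⟨i, h⟩ else 0
    have hv : restr s v = u := by
      funext i
      simp [restr, v]
    obtain ⟨x, hx, hxq, hxv⟩ := h1 v ((hWr v).1 (hv ▸ hu))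
    exact ⟨x, hx, hxq, by rw [(hdist _ _).1 hxv, hv]⟩
  choose! f hfX hfq hfr using hex
  have huniq : ∀ y, X y → sqDistOn Finset.univ y q < ε → ∀ x, X x → sqDistOn Finset.univ x q < ε →
      restr s x = restr s y → x = y := by
    intro y hy hyq x hx hxq hxy
    obtain ⟨c, hc⟩ := h2 y hy hyq
    -- Both points have the value at `0` of the expansion at `y` as their coordinates.
    have key : ∀ x, X x → sqDistOn Finset.univ x q < ε → restr s x = restr s y → ∀ j,
        x j = ∑ α, c (j, α) * boxMonomial α (0 : s → ℝ) := by
      intro x hx hxq hxy j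
      have h3 := hc x hx hxq
      rw [(hdist x y).2 hxy, zero_pow (by omega)] at h3
      have h4 := (Finset.sum_eq_zero_iff_of_nonneg fun i _ => sq_nonneg _).1
        (le_antisymm h3 (Finset.sum_nonneg fun i _ => sq_nonneg _)) j (Finset.mem_univ j)
      have h5 : (fun i : s => x i - y i) = 0 := by
        funext i
        exact sub_eq_zero.2 (congrFun hxy i)
      rw [h5] at h4
      exact sub_eq_zero.1 (pow_eq_zero_iff two_ne_zero |>.1 h4)
    funext j
    rw [key x hx hxq hxy j, key y hy hyq rfl j]
  refine ⟨{x | sqDistOn Finset.univ x q < ε} ∩ {x | sqDistOn s x q < ε'}, W, f,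
    (isOpen_sqDistOn_lt _ _ _).inter (isOpen_sqDistOn_lt _ _ _),
    isOpen_lt (by fun_prop) continuous_const, ⟨hp, hp'⟩, fun x hx => (hWr x).2 hx.2,
    fun x hx hXx => ⟨hXx, q, ε, ε', hx.1, hx.2, h1, h2⟩, fun u hu => ⟨⟨hfq u hu, ?_⟩, hfX u hu,
      hfr u hu⟩, fun x hx hXx => ?_, fun j => ?_⟩
  · exact (hWr _).1 ((hfr u hu).symm ▸ hu)
  · have hxW := (hWr x).2 hx.2
    exact huniq x hXx hx.1 _ (hfX _ hxW) (hfq _ hxW) (hfr _ hxW)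
  · refine ⟨(s.card + 1) ^ (r + 1), fun u hu => ?_⟩
    obtain ⟨c, hc⟩ := h2 (f u) (hfX u hu) (hfq u hu)
    refine ⟨fun h => ∑ α, c (j, α) * boxMonomial α h,
      mem_boxPoly_iff.2 ⟨fun α => c (j, α), fun _ => rfl⟩, fun v hv => ?_⟩
    have h3 := hc (f v) (hfX v hv) (hfq v hv)
    have hsub : (fun i : s => f v i - f u i) = v - u := by
      funext i
      rw [Pi.sub_apply, ← congrFun (hfr v hv) i, ← congrFun (hfr u hu) i]
      rfl
    have hsq : sqDistOn s (f v) (f u) ≤ (s.card + 1) * ‖v - u‖ ^ 2 := by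
      have h4 : ∀ i ∈ s, (f v i - f u i) ^ 2 ≤ ‖v - u‖ ^ 2 := by
        intro i hi
        have h5 : f v i - f u i = (v - u) ⟨i, hi⟩ := congrFun hsub ⟨i, hi⟩
        rw [h5, ← sq_abs]
        exact pow_le_pow_left₀ (abs_nonneg _) (norm_le_pi_norm (v - u) ⟨i, hi⟩) 2
      have h5 := Finset.sum_le_card_nsmul _ _ _ h4
      rw [nsmul_eq_mul] at h5
      have : (0 : ℝ) ≤ ‖v - u‖ ^ 2 := by positivity
      unfold sqDistOn
      linarith
    have h4 : (f v j - ∑ α, c (j, α) * boxMonomial α fun i : s => f v i - f u i) ^ 2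
        ≤ sqDistOn s (f v) (f u) ^ (r + 1) :=
      (Finset.single_le_sum (f := fun j => (f v j - ∑ α, c (j, α) * boxMonomial α
        fun i : s => f v i - f u i) ^ 2) (fun _ _ => sq_nonneg _) (Finset.mem_univ j)).trans h3
    rw [hsub] at h4
    refine abs_le_of_sq_le_sq (h4.trans ?_) (by positivity)
    have h0 : 0 ≤ sqDistOn s (f v) (f u) := Finset.sum_nonneg fun _ _ => sq_nonneg _
    calc sqDistOn s (f v) (f u) ^ (r + 1) ≤ ((s.card + 1) * ‖v - u‖ ^ 2) ^ (r + 1) :=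
          pow_le_pow_left₀ h0 hsq _
      _ = (s.card + 1) ^ (r + 1) * (‖v - u‖ ^ (r + 1)) ^ 2 := by rw [mul_pow]; ring
      _ ≤ ((s.card + 1) ^ (r + 1)) ^ 2 * (‖v - u‖ ^ (r + 1)) ^ 2 := by
          have : (1 : ℝ) ≤ (s.card + 1) ^ (r + 1) :=
            one_le_pow₀ (by linarith [s.card.cast_nonneg (α := ℝ)])
          gcongr
          nlinarith
      _ = ((s.card + 1) ^ (r + 1) * ‖v - u‖ ^ (r + 1)) ^ 2 := by ring

end Regular

/-! ### Existence of regular points -/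

section Existence

variable {ℓ : ℕ}

theorem norm_sq_le_sum_sq {ι : Type*} [Fintype ι] (h : ι → ℝ) : ‖h‖ ^ 2 ≤ ∑ i, h i ^ 2 := by
  have h0 : 0 ≤ ∑ i, h i ^ 2 := Finset.sum_nonneg fun _ _ => sq_nonneg _
  rw [← Real.sq_sqrt h0]
  refine pow_le_pow_left₀ (norm_nonneg _) ((pi_norm_le_iff_of_nonneg (Real.sqrt_nonneg _)).2
    fun i => Real.le_sqrt_of_sq_le ?_) 2
  rw [Real.norm_eq_abs, sq_abs]
  exact Finset.single_le_sum (f := fun i => h i ^ 2) (fun _ _ => sq_nonneg _) (Finset.mem_univ i)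

theorem abs_sub_lt_of_sqDistOn {s : Finset (Fin ℓ)} {x y : Fin ℓ → ℝ} {δ : ℝ} (hδ : 0 < δ)
    (h : sqDistOn s x y < δ ^ 2) {i : Fin ℓ} (hi : i ∈ s) : |x i - y i| < δ := by
  refine abs_lt_of_sq_lt_sq (lt_of_le_of_lt ?_ h) hδ.le
  exact Finset.single_le_sum (f := fun i => (x i - y i) ^ 2) (fun _ _ => sq_nonneg _) hi

theorem sqDistOn_self (s : Finset (Fin ℓ)) (x : Fin ℓ → ℝ) : sqDistOn s x x = 0 := by
  simp [sqDistOn]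

theorem sqDistOn_eq_zero {s : Finset (Fin ℓ)} {x y : Fin ℓ → ℝ} (h : restr s x = restr s y) :
    sqDistOn s x y = 0 :=
  Finset.sum_eq_zero fun i hi => by
    have : x i = y i := congrFun h ⟨i, hi⟩
    simp [this]

/-- A graph with Taylor expansions of one order more than required consists of regular points: the
additional order absorbs the constant in the remainder, on a small ball. -/
theorem isRegularPt_of_taylorOn {r : ℕ} {s : Finset (Fin ℓ)} {X : (Fin ℓ → ℝ) → Prop}
    {B : Set (Fin ℓ → ℝ)} {V : Set (s → ℝ)} {f : (s → ℝ) → Fin ℓ → ℝ} (hB : IsOpen B)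
    (hV : IsOpen V) (hf : ∀ u ∈ V, f u ∈ B ∧ X (f u) ∧ restr s (f u) = u)
    (hfX : ∀ x ∈ B, X x → restr s x ∈ V → f (restr s x) = x)
    (hT : ∀ j, TaylorOn (r + 3) (r + 2) (fun u => f u j) V) {u₀ : s → ℝ} (hu₀ : u₀ ∈ V) :
    IsRegularPt r s X (f u₀) := by
  choose M hM using hT
  set K : ℝ := ∑ j, |M j|
  have hK0 : 0 ≤ K := Finset.sum_nonneg fun _ _ => abs_nonneg _
  have hMK : ∀ j, M j ≤ K := fun j => (le_abs_self _).trans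
    (Finset.single_le_sum (f := fun j => |M j|) (fun _ _ => abs_nonneg _) (Finset.mem_univ j))
  set p := f u₀ with hp
  have hpu : restr s p = u₀ := (hf u₀ hu₀).2.2
  have hrc : Continuous (restr s : (Fin ℓ → ℝ) → s → ℝ) := by unfold restr; fun_prop
  obtain ⟨δ₀, hδ₀, hball⟩ := Metric.isOpen_iff.1 (hB.inter (hV.preimage hrc)) p
    ⟨(hf u₀ hu₀).1, by rw [mem_preimage, hpu]; exact hu₀⟩
  obtain ⟨δ₁, hδ₁, hsmall⟩ : ∃ δ₁ > 0, (ℓ : ℝ) * K ^ 2 * (2 * δ₁) ^ 2 ≤ 1 := by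
    refine ⟨1 / (2 * (ℓ * K + 1)), by positivity, ?_⟩
    have h1 : (2 * (1 / (2 * ((ℓ : ℝ) * K + 1)))) = 1 / (ℓ * K + 1) := by
      have : (ℓ : ℝ) * K + 1 ≠ 0 := by positivity
      field_simp
    rw [h1, div_pow, one_pow, mul_one_div, div_le_one (by positivity)]
    rcases Nat.eq_zero_or_pos ℓ with h | h
    · subst h; simp
    · have : (1 : ℝ) ≤ ℓ := by exact_mod_cast h
      nlinarith [mul_nonneg (Nat.cast_nonneg (α := ℝ) ℓ) hK0, sq_nonneg K,
        mul_nonneg (mul_nonneg (Nat.cast_nonneg (α := ℝ) ℓ) (sq_nonneg K)) (sub_nonneg.2 this)]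
  set δ := min δ₀ δ₁
  have hδ : 0 < δ := lt_min hδ₀ hδ₁
  have hδle : δ ≤ δ₀ := min_le_left _ _
  have hδ1 : (ℓ : ℝ) * K ^ 2 * (2 * δ) ^ 2 ≤ 1 := by
    refine le_trans ?_ hsmall
    have : δ ≤ δ₁ := min_le_right _ _
    gcongr
  have hnear : ∀ x, X x → sqDistOn Finset.univ x p < δ ^ 2 →
      restr s x ∈ V ∧ f (restr s x) = x ∧ ∀ i, |x i - p i| < δ := by
    intro x hx hxp
    have h1 : ∀ i, |x i - p i| < δ := fun i => abs_sub_lt_of_sqDistOn hδ hxp (Finset.mem_univ i)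
    have h2 : x ∈ Metric.ball p δ₀ := by
      rw [Metric.mem_ball, dist_pi_lt_iff hδ₀]
      exact fun i => by rw [Real.dist_eq]; exact (h1 i).trans_le hδle
    exact ⟨(hball h2).2, hfX x (hball h2).1 hx (hball h2).2, h1⟩
  have hcont : ContinuousAt f u₀ := by
    refine continuousAt_pi.2 fun j => ?_
    have : TaylorOn (r + 3) (r + 1 + 1) (fun u => f u j) V := ⟨M j, hM j⟩
    exact (this.contDiffAt hV hu₀).continuousAt
  obtain ⟨δ', hδ', hball'⟩ : ∃ δ' > 0, ∀ u, dist u u₀ < δ' →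
      u ∈ V ∧ sqDistOn Finset.univ (f u) p < δ ^ 2 := by
    have h1 : ∀ᶠ u in 𝓝 u₀, f u ∈ {x | sqDistOn Finset.univ x p < δ ^ 2} :=
      hcont.eventually ((isOpen_sqDistOn_lt _ _ _).mem_nhds (by
        rw [mem_ofPred_eq, ← hp, sqDistOn_self]; positivity))
    have h0 : ∀ᶠ u in 𝓝 u₀, u ∈ V := hV.mem_nhds hu₀
    exact Metric.eventually_nhds_iff.1 (h0.and h1)
  refine ⟨(hf u₀ hu₀).2.1, p, δ ^ 2, δ' ^ 2, by rw [sqDistOn_self]; positivity,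
    by rw [sqDistOn_self]; positivity, fun u hu => ?_, fun y hy hyp => ?_⟩
  · have h1 : dist (restr s u) u₀ < δ' := by
      rw [dist_pi_lt_iff hδ']
      intro i
      rw [Real.dist_eq, ← hpu]
      exact abs_sub_lt_of_sqDistOn hδ' hu i.2
    obtain ⟨h2, h3⟩ := hball' _ h1
    exact ⟨f (restr s u), (hf _ h2).2.1, h3, sqDistOn_eq_zero (hf _ h2).2.2⟩
  · obtain ⟨hyV, hyf, hyδ⟩ := hnear y hy hyp
    have hc : ∀ j, ∃ c : (s → Fin (r + 3)) → ℝ, ∀ v ∈ V,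
        |f v j - ∑ α, c α * boxMonomial α (v - restr s y)| ≤ M j * ‖v - restr s y‖ ^ (r + 2) := by
      intro j
      obtain ⟨P, hP, h⟩ := hM j _ hyV
      obtain ⟨c, hc⟩ := mem_boxPoly_iff.1 hP
      exact ⟨c, fun v hv => by rw [← hc]; exact h v hv⟩
    choose c hc using hc
    refine ⟨fun k => c k.1 k.2, fun x hx hxp => ?_⟩
    obtain ⟨hxV, hxf, hxδ⟩ := hnear x hx hxp
    set h := restr s x - restr s y with hh
    have hsum : sqDistOn s x y = ∑ i, h i ^ 2 := by
      rw [sqDistOn, ← Finset.sum_coe_sort s fun i => (x i - y i) ^ 2]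
      rfl
    have hnorm : ‖h‖ ≤ 2 * δ := by
      refine (pi_norm_le_iff_of_nonneg (by positivity)).2 fun i => ?_
      have h1 : h i = (x i - p i) - (y i - p i) := by simp [hh, restr]
      rw [h1, Real.norm_eq_abs]
      refine (abs_sub _ _).trans ?_
      linarith [hxδ i, hyδ i]
    have hterm : ∀ j ∈ Finset.univ, (x j - ∑ α, c j α * boxMonomial α fun i : s => x i - y i) ^ 2
        ≤ (K * ‖h‖ ^ (r + 2)) ^ 2 := by
      intro j _
      have h1 := hc j _ hxV
      rw [hxf] at h1
      refine sq_le_sq' ?_ ?_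
      · have := (abs_le.1 h1).1
        have h2 : M j * ‖h‖ ^ (r + 2) ≤ K * ‖h‖ ^ (r + 2) :=
          mul_le_mul_of_nonneg_right (hMK j) (by positivity)
        exact le_trans (neg_le_neg h2) this
      · exact (abs_le.1 h1).2.trans (mul_le_mul_of_nonneg_right (hMK j) (by positivity))
    refine (Finset.sum_le_card_nsmul _ _ _ hterm).trans ?_
    rw [Finset.card_univ, Fintype.card_fin, nsmul_eq_mul, hsum]
    calc (ℓ : ℝ) * (K * ‖h‖ ^ (r + 2)) ^ 2 = (ℓ * K ^ 2 * ‖h‖ ^ 2) * (‖h‖ ^ 2) ^ (r + 1) := by ring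
      _ ≤ 1 * (‖h‖ ^ 2) ^ (r + 1) := by
          refine mul_le_mul_of_nonneg_right (le_trans ?_ hδ1) (by positivity)
          gcongr
      _ ≤ (∑ i, h i ^ 2) ^ (r + 1) := by
          rw [one_mul]
          exact pow_le_pow_left₀ (by positivity) (norm_sq_le_sum_sq h) _

theorem IsFiniteUnionOfIntervals.finite {C : Set ℝ} (hC : IsFiniteUnionOfIntervals C)
    (h : ∀ q q' : ℚ, q < q' → ¬ Ioo (q : ℝ) q' ⊆ C) : C.Finite := by
  obtain ⟨I, hI, hc, rfl⟩ := hC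
  refine hI.sUnion fun J hJ => Set.Subsingleton.finite ?_
  by_contra hns
  obtain ⟨x, hx, y, hy, hxy⟩ := (not_subsingleton_iff.1 hns).exists_lt
  obtain ⟨q, hq1, hq2⟩ := exists_rat_btwn hxy
  obtain ⟨q', hq'1, hq'2⟩ := exists_rat_btwn hq2
  exact h q q' (by exact_mod_cast hq'1) fun t ht =>
    ⟨J, hJ, (hc J hJ).out hx hy ⟨(hq1.trans ht.1).le, (ht.2.trans hq'2).le⟩⟩

variable {S : OMinimalExpansion} {Ω : FDFiltration S}

theorem isDef_restr_eq (hΩ : IsPresharp Ω) {κ : Type} [Fintype κ] (s : Finset (Fin ℓ))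
    (a : Fin ℓ → κ) (b : s → κ) :
    IsDef Ω fun z : κ → ℝ => restr s (fun i => z (a i)) = fun i => z (b i) :=
  (Sharp.forall_finset hΩ (.const _) Finset.univ fun (i : s) _ => Sharp.poly_eq hΩ (.const _)
    (.coord fun _ => a i) (.coord fun _ => b i)).congr fun _ z => by simp [restr, funext_iff]

theorem isDef_box (hΩ : IsPresharp Ω) {κ : Type} [Fintype κ] (e : Fin ℓ → κ) (a b : Fin ℓ → ℚ) :
    IsDef Ω fun z : κ → ℝ => ∀ i, (a i : ℝ) < z (e i) ∧ z (e i) < b i :=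
  (Sharp.forall_finset hΩ (.const _) Finset.univ fun i _ => Sharp.and hΩ
    (Sharp.poly_lt hΩ (.const _) (.const (a i : ℝ)) (.coord fun _ => e i))
    (Sharp.poly_lt hΩ (.const _) (.coord fun _ => e i) (.const (b i : ℝ)))).congr
    fun _ z => by simp

/-- The point `x` of `Z` over `u` is the only point of `X` over `u` in the box between `a` and `b`. -/
def IsIsolatedIn (X Z : (Fin ℓ → ℝ) → Prop) (s : Finset (Fin ℓ)) (a b : Fin ℓ → ℚ) (u : s → ℝ)
    (x : Fin ℓ → ℝ) : Prop :=
  Z x ∧ (∀ i, (a i : ℝ) < x i ∧ x i < b i) ∧ restr s x = u ∧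
    ∀ y : Fin ℓ → ℝ, X y → (∀ i, (a i : ℝ) < y i ∧ y i < b i) → restr s y = u → y = x

theorem isDef_isIsolatedIn (hΩ : IsPresharp Ω) {X Z : (Fin ℓ → ℝ) → Prop} (hX : IsDef Ω X)
    (hZ : IsDef Ω Z) (s : Finset (Fin ℓ)) (a b : Fin ℓ → ℚ) :
    IsDef Ω fun z : s ⊕ Fin ℓ → ℝ =>
      IsIsolatedIn X Z s a b (fun i => z (Sum.inl i)) (fun i => z (Sum.inr i)) := by
  refine .and hΩ (.subst hΩ hZ (.const _) _) (.and hΩ (isDef_box hΩ _ a b) (.and hΩ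
    (isDef_restr_eq hΩ s _ _) (.all hΩ (.imp hΩ (.subst hΩ hX (.const _) _) (.imp hΩ
    (isDef_box hΩ _ a b) (.imp hΩ (isDef_restr_eq hΩ s _ _) ?_))))))
  exact (Sharp.forall_finset hΩ (.const _) Finset.univ fun (i : Fin ℓ) _ => Sharp.poly_eq hΩ
    (.const _) (.coord fun _ => Sum.inr i) (.coord fun _ => Sum.inl (Sum.inr i))).congr
    fun _ z => by simp [funext_iff]

/-- `t` is the `j`-th coordinate of a point of `X` over `u`. -/
def IsFibreValue (X : (Fin ℓ → ℝ) → Prop) (s : Finset (Fin ℓ)) (j : Fin ℓ) (u : s → ℝ) (t : ℝ) :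
    Prop :=
  ∃ x : Fin ℓ → ℝ, X x ∧ restr s x = u ∧ x j = t

theorem isDef_isFibreValue (hΩ : IsPresharp Ω) {X : (Fin ℓ → ℝ) → Prop} (hX : IsDef Ω X)
    (s : Finset (Fin ℓ)) (j : Fin ℓ) :
    IsDef Ω fun z : s ⊕ Unit → ℝ => IsFibreValue X s j (fun i => z (Sum.inl i)) (z (Sum.inr ())) :=
  .ex hΩ (.and hΩ (.subst hΩ hX (.const _) _) (.and hΩ (isDef_restr_eq hΩ s _ _)
    (.poly_eq hΩ (.const _) (.coord fun _ => Sum.inr j) (.coord fun _ => Sum.inl (Sum.inr ())))))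

/-- A fibre without an interval in one of its coordinate projections is finite, so that its points
can be isolated by boxes with rational vertices. -/
theorem exists_isIsolatedIn (hΩ : IsPresharp Ω) {X Z : (Fin ℓ → ℝ) → Prop} (hX : IsDef Ω X)
    {s : Finset (Fin ℓ)} {u : s → ℝ} {z : Fin ℓ → ℝ} (hz : Z z) (hzu : restr s z = u)
    (h : ∀ j ∉ s, ∀ q q' : ℚ, q < q' → ¬ Ioo (q : ℝ) q' ⊆ {t | IsFibreValue X s j u t}) :
    ∃ a b, IsIsolatedIn X Z s a b u z := by
  have hfin : {x | X x ∧ restr s x = u}.Finite := by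
    refine (Set.Finite.pi (t := fun j => {t | IsFibreValue X s j u t}) fun j => ?_).subset
      fun x hx j _ => ⟨x, hx.1, hx.2, rfl⟩
    by_cases hj : j ∈ s
    · refine (Set.finite_singleton (u ⟨j, hj⟩)).subset ?_
      rintro t ⟨x, -, hxu, rfl⟩
      exact congrFun hxu ⟨j, hj⟩
    · refine IsFiniteUnionOfIntervals.finite ?_ (h j hj)
      exact (isDef_isFibreValue hΩ hX s j).line hΩ (g := fun k y => Sum.elim u (fun _ => y 0) k)
        fun k => by
          rcases k with k | k
          · exact PolyFamily.const (u k)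
          · exact PolyFamily.coord fun _ => (0 : Fin 1)
  have hopen : IsOpen ({x | X x ∧ restr s x = u} \ {z})ᶜ :=
    (hfin.subset sdiff_subset).isClosed.isOpen_compl
  obtain ⟨δ, hδ, hball⟩ := Metric.isOpen_iff.1 hopen z (by simp)
  choose a ha1 ha2 using fun i => exists_rat_btwn (by linarith : z i - δ < z i)
  choose b hb1 hb2 using fun i => exists_rat_btwn (by linarith : z i < z i + δ)
  refine ⟨a, b, hz, fun i => ⟨ha2 i, hb1 i⟩, hzu, fun y hy hyb hyu => ?_⟩
  by_contra hne
  have hyz : y ∈ Metric.ball z δ := by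
    rw [Metric.mem_ball, dist_pi_lt_iff hδ]
    intro i
    rw [Real.dist_eq, abs_lt]
    constructor <;> linarith [ha1 i, hb2 i, (hyb i).1, (hyb i).2]
  exact hball hyz ⟨⟨hy, hyu⟩, hne⟩

/-- If no projection of `X` to more than `s.card` coordinates has interior points, then every
definable subset of `X` whose projection to the coordinates `s` has interior points contains a
regular point of `X`. -/
theorem exists_isRegularPt (hΩ : IsPresharp Ω) (r : ℕ) {X Z : (Fin ℓ → ℝ) → Prop}
    (hX : IsDef Ω X) (hZ : IsDef Ω Z) (hZX : ∀ x, Z x → X x) {s : Finset (Fin ℓ)}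
    (hdim : ∀ t : Finset (Fin ℓ), (interior (restr t '' {x | X x})).Nonempty → t.card ≤ s.card)
    (hint : (interior (restr s '' {x | Z x})).Nonempty) : ∃ x, Z x ∧ IsRegularPt r s X x := by
  let A : ({j // j ∉ s} × ℚ × ℚ) ⊕ ((Fin ℓ → ℚ) × (Fin ℓ → ℚ)) → (s → ℝ) → Prop
    | .inl (j, q, q'), u => (q : ℝ) < q' ∧ ∀ t : ℝ, (q : ℝ) < t → t < q' → IsFibreValue X s j u t
    | .inr (a, b), u => ∃ x, IsIsolatedIn X Z s a b u x
  have hA : ∀ k, IsDef Ω (A k) := by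
    rintro (⟨j, q, q'⟩ | ⟨a, b⟩)
    · refine .and hΩ (.poly_lt hΩ (.const _) (.const _) (.const _)) (.all_real hΩ (.imp hΩ
        (.poly_lt hΩ (.const _) (.const _) (.coord _)) (.imp hΩ
        (.poly_lt hΩ (.const _) (.coord _) (.const _)) ?_)))
      exact isDef_isFibreValue hΩ hX s j
    · exact .ex hΩ (isDef_isIsolatedIn hΩ hX hZ s a b)
  have hcov : ∀ u ∈ interior (restr s '' {x | Z x}), ∃ k, A k u := by
    intro u hu
    obtain ⟨z, hz, hzu⟩ := interior_subset hu
    by_cases h : ∃ j ∉ s, ∃ q q' : ℚ, q < q' ∧ Ioo (q : ℝ) q' ⊆ {t | IsFibreValue X s j u t}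
    · obtain ⟨j, hj, q, q', hq, hs⟩ := h
      exact ⟨.inl (⟨j, hj⟩, q, q'), by exact_mod_cast hq, fun t h1 h2 => hs ⟨h1, h2⟩⟩
    · push Not at h
      obtain ⟨a, b, hab⟩ := exists_isIsolatedIn (Z := Z) hΩ hX hz hzu h
      exact ⟨.inr (a, b), z, hab⟩
  obtain ⟨k, V, hVU, hVo, ⟨v, hv⟩, hV⟩ :=
    IsDef.exists_open_of_cover hΩ hA isOpen_interior hint hcov
  rcases k with ⟨⟨j, hj⟩, q, q'⟩ | ⟨a, b⟩
  · -- The projection of `X` to the coordinates `s` and `j` would have interior points.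
    exfalso
    have hle := hdim (insert j s) ?_
    · rw [Finset.card_insert_of_notMem hj] at hle
      omega
    let O : Set (↥(insert j s) → ℝ) :=
      {w | (fun i : s => w ⟨i, Finset.mem_insert_of_mem i.2⟩) ∈ V ∧
        w ⟨j, Finset.mem_insert_self j s⟩ ∈ Ioo (q : ℝ) q'}
    have hO : IsOpen O :=
      (hVo.preimage (by fun_prop)).inter (isOpen_Ioo.preimage (by fun_prop))
    have hsub : O ⊆ restr (insert j s) '' {x | X x} := by
      rintro w ⟨hw1, hw2⟩
      obtain ⟨x, hx, hxu, hxj⟩ := (hV _ hw1).2 _ hw2.1 hw2.2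
      refine ⟨x, hx, funext fun i => ?_⟩
      obtain ⟨i, hi⟩ := i
      rcases Finset.mem_insert.1 hi with rfl | his
      · exact hxj
      · exact congrFun hxu ⟨i, his⟩
    refine Set.Nonempty.mono (interior_maximal hsub hO) ?_
    obtain ⟨t, ht⟩ := nonempty_Ioo.2 (hV v hv).1
    refine ⟨fun i => if h : (i : Fin ℓ) ∈ s then v ⟨i, h⟩ else t, ?_, ?_⟩
    · simpa using hv
    · simpa [hj] using ht
  · classical
    let f : (s → ℝ) → Fin ℓ → ℝ := fun u =>
      if h : ∃ x, IsIsolatedIn X Z s a b u x then h.choose else 0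
    have hf : ∀ u x, IsIsolatedIn X Z s a b u x → f u = x := by
      intro u x hx
      have h : ∃ x, IsIsolatedIn X Z s a b u x := ⟨x, hx⟩
      simp only [f, dif_pos h]
      have := h.choose_spec
      exact hx.2.2.2 _ (hZX _ this.1) this.2.1 this.2.2.1
    have hdef : ∀ j, IsDefFun Ω fun u => f u j := by
      intro j
      have h1 : IsDef Ω fun z : s ⊕ Unit → ℝ => ∃ x : Fin ℓ → ℝ,
          IsIsolatedIn X Z s a b (fun i => z (Sum.inl i)) x ∧ z (Sum.inr ()) = x j :=
        .ex hΩ (.and hΩ (.subst hΩ (isDef_isIsolatedIn hΩ hX hZ s a b) (.const _)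
          fun _ => Sum.elim (fun i => Sum.inl (Sum.inl i)) Sum.inr)
          (.poly_eq hΩ (.const _) (.coord fun _ => Sum.inl (Sum.inr ()))
            (.coord fun _ => Sum.inr j)))
      have h2 : IsDef Ω fun z : s ⊕ Unit → ℝ => (¬ A (.inr (a, b)) fun i => z (Sum.inl i)) ∧
          z (Sum.inr ()) = 0 :=
        .and hΩ (.not hΩ (.subst hΩ (hA (.inr (a, b))) (.const _) fun _ => Sum.inl))
          (.poly_eq hΩ (.const _) (.coord fun _ => Sum.inr ()) (.const 0))
      refine (h1.or hΩ h2).congr fun _ z => ?_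
      change z (Sum.inr ()) = f (fun i => z (Sum.inl i)) j ↔ _
      by_cases h : ∃ x, IsIsolatedIn X Z s a b (fun i => z (Sum.inl i)) x
      · obtain ⟨x, hx⟩ := h
        have h3 := hf _ x hx
        constructor
        · intro hz
          exact .inl ⟨x, hx, by rw [hz, h3]⟩
        · rintro (⟨y, hy, hzy⟩ | ⟨hn, -⟩)
          · rw [hzy, hf _ y hy]
          · exact absurd ⟨x, hx⟩ hn
      · have h3 : f (fun i => z (Sum.inl i)) = 0 := by simp only [f, dif_neg h]
        rw [h3, Pi.zero_apply]
        constructor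
        · intro hz
          exact .inr ⟨h, hz⟩
        · rintro (⟨y, hy, -⟩ | ⟨-, hz⟩)
          · exact absurd ⟨y, hy⟩ h
          · exact hz
    obtain ⟨V', hV'V, hV'o, ⟨u₀, hu₀⟩, hT⟩ := exists_open_forall Finset.univ
      (p := fun j V => TaylorOn (r + 2 + 1) (r + 2) (fun u => f u j) V)
      (fun j _ _ h hV => hV.mono h)
      (fun j U hU hne => (hdef j).exists_open_taylorOn hΩ (r + 2) hU hne) hVo ⟨v, hv⟩
    have hiso : ∀ u ∈ V', IsIsolatedIn X Z s a b u (f u) := by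
      intro u hu
      obtain ⟨x, hx⟩ := hV u (hV'V hu)
      rwa [hf u x hx]
    have hbox : IsOpen {x : Fin ℓ → ℝ | ∀ i, (a i : ℝ) < x i ∧ x i < b i} := by
      have : {x : Fin ℓ → ℝ | ∀ i, (a i : ℝ) < x i ∧ x i < b i}
          = Set.pi univ fun i => Ioo (a i : ℝ) (b i) := by
        ext x; simp
      rw [this]
      exact isOpen_set_pi finite_univ fun i _ => isOpen_Ioo
    refine ⟨f u₀, (hiso u₀ hu₀).1, isRegularPt_of_taylorOn hbox hV'o
      (fun u hu => ⟨(hiso u hu).2.1, hZX _ (hiso u hu).1, (hiso u hu).2.2.1⟩)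
      (fun x hxB hx hxV => ((hiso _ hxV).2.2.2 x hx hxB rfl).symm)
      (fun j => hT j (Finset.mem_univ j)) hu₀⟩

end Existence

/-! ### Charts -/

section Charts

variable {ℓ : ℕ}

/-- A permutation of the coordinates that moves the coordinates in `s` to the front. -/
theorem exists_perm_front (s : Finset (Fin ℓ)) :
    ∃ e : Equiv.Perm (Fin ℓ), ∀ i, ((e i : Fin ℓ) : ℕ) < s.card ↔ i ∈ s := by
  have hs : s.card ≤ ℓ := by simpa using s.card_le_univ
  have hcard : Fintype.card {i : Fin ℓ // i ∈ s}
      = Fintype.card {i : Fin ℓ // (i : ℕ) < s.card} := by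
    rw [Fintype.card_coe, Fintype.card_subtype]
    have h1 : (Finset.univ.filter fun i : Fin ℓ => (i : ℕ) < s.card)
        = (Finset.univ : Finset (Fin s.card)).map (Fin.castLEEmb hs) := by
      ext i
      simp only [Finset.mem_filter, Finset.mem_univ, true_and, Finset.mem_map]
      constructor
      · intro hi
        exact ⟨⟨i, hi⟩, by ext; rfl⟩
      · rintro ⟨k, rfl⟩
        exact k.2
    rw [h1]
    simp
  let e := Fintype.equivOfCardEq hcard
  refine ⟨e.extendSubtype, fun i => ⟨fun hi => ?_, fun hi => e.extendSubtype_mem i hi⟩⟩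
  by_contra his
  exact e.extendSubtype_not_mem i his hi

theorem continuous_restr (s : Finset (Fin ℓ)) : Continuous (restr s) := by
  unfold restr
  fun_prop

theorem contDiff_restr {n : WithTop ℕ∞} (s : Finset (Fin ℓ)) : ContDiff ℝ n (restr s) := by
  unfold restr
  fun_prop

/-- A set that near each of its points is the graph over some `k` coordinates of a `C^r` map is an
embedded submanifold: subtracting the map from the remaining coordinates straightens it. -/
theorem isEmbeddedSubmanifold_of_graph {r k : ℕ} (hk : k ≤ ℓ) {Y : Set (Fin ℓ → ℝ)}
    (hY : ∀ p ∈ Y, ∃ (s : Finset (Fin ℓ)) (V : Set (Fin ℓ → ℝ)) (W : Set (s → ℝ))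
      (f : (s → ℝ) → Fin ℓ → ℝ), s.card = k ∧ IsOpen V ∧ IsOpen W ∧ p ∈ V ∧
      (∀ x ∈ V, restr s x ∈ W) ∧ (∀ u ∈ W, f u ∈ Y ∧ restr s (f u) = u) ∧
      (∀ x ∈ V, x ∈ Y → f (restr s x) = x) ∧ ∀ j, ContDiffOn ℝ r (fun u => f u j) W) :
    IsEmbeddedSubmanifold r k Y := by
  refine ⟨hk, fun p hp => ?_⟩
  obtain ⟨s, V, W, f, rfl, hVo, hWo, hpV, hVW, hfY, hYf, hf⟩ := hY p hp
  obtain ⟨e, he⟩ := exists_perm_front s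
  let K : (Fin ℓ → ℝ) → Fin ℓ → ℝ := fun x j => if j ∈ s then 0 else f (restr s x) j
  have hKr : ∀ x y, restr s x = restr s y → K x = K y := by
    intro x y h
    funext j
    simp only [K, h]
  have hsub : ∀ x, restr s (x - K x) = restr s x := fun x => by
    funext i
    simp [restr, K]
  have hadd : ∀ x, restr s (x + K x) = restr s x := fun x => by
    funext i
    simp [restr, K]
  have hK : ∀ {D : Set (Fin ℓ → ℝ)}, (∀ x ∈ D, restr s x ∈ W) → ContDiffOn ℝ r K D := by
    intro D hD
    refine contDiffOn_pi.2 fun j => ?_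
    by_cases hj : j ∈ s
    · simpa [K, hj] using contDiffOn_const
    · simp only [K, if_neg hj]
      exact (hf j).comp (contDiff_restr s).contDiffOn hD
  let φ : (Fin ℓ → ℝ) → Fin ℓ → ℝ := fun x i => (x - K x) (e.symm i)
  let ψ : (Fin ℓ → ℝ) → Fin ℓ → ℝ := fun y => (fun j => y (e j)) + K (fun j => y (e j))
  have hφe : ∀ x, (fun j => φ x (e j)) = x - K x := fun x => by
    funext j
    simp [φ]
  have hψφ : ∀ x, ψ (φ x) = x := by
    intro x
    simp only [ψ, hφe]
    rw [hKr (x - K x) x (hsub x), sub_add_cancel]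
  have hφψ : ∀ y, φ (ψ y) = y := by
    intro y
    funext i
    simp only [φ]
    rw [hKr (ψ y) (fun j => y (e j)) (hadd _)]
    simp [ψ]
  let T : Set (Fin ℓ → ℝ) := {y | restr s (fun j => y (e j)) ∈ W}
  have hT : IsOpen T := hWo.preimage ((continuous_restr s).comp (by fun_prop))
  have hφc : ContDiffOn ℝ r φ V := by
    refine contDiffOn_pi.2 fun i => ?_
    exact contDiffOn_pi.1 (contDiffOn_id.sub (hK hVW)) (e.symm i)
  have hψc : ContDiffOn ℝ r ψ T := by
    have hlin : ContDiff ℝ r fun (y : Fin ℓ → ℝ) (j : Fin ℓ) => y (e j) := by fun_prop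
    exact hlin.contDiffOn.add
      ((hK (D := {x | restr s x ∈ W}) fun x hx => hx).comp hlin.contDiffOn fun y hy => hy)
  have hψr : ∀ y, restr s (ψ y) = restr s (fun j => y (e j)) := fun y => hadd _
  have hφT : ∀ x ∈ V, φ x ∈ T := fun x hx => by
    have := hVW x hx
    rwa [← hψφ x, hψr] at this
  let Φ : OpenPartialHomeomorph (Fin ℓ → ℝ) (Fin ℓ → ℝ) :=
    { toFun := φ
      invFun := ψ
      source := V
      target := T ∩ ψ ⁻¹' V
      map_source' := fun x hx => ⟨hφT x hx, by rwa [mem_preimage, hψφ]⟩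
      map_target' := fun y hy => hy.2
      left_inv' := fun x _ => hψφ x
      right_inv' := fun y _ => hφψ y
      open_source := hVo
      open_target := hψc.continuousOn.isOpen_inter_preimage hT hVo
      continuousOn_toFun := hφc.continuousOn
      continuousOn_invFun := hψc.continuousOn.mono inter_subset_left }
  refine ⟨Φ, hpV, hφc, hψc.mono inter_subset_left, ?_⟩
  have hΦ : ∀ x, Φ x = φ x := fun _ => rfl
  have hes : ∀ i : Fin ℓ, s.card ≤ (i : ℕ) ↔ e.symm i ∉ s := fun i => by
    rw [← he, Equiv.apply_symm_apply, not_lt]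
  apply Subset.antisymm
  · rintro _ ⟨x, ⟨hxV, hxY⟩, rfl⟩
    refine ⟨Φ.map_source hxV, fun i hi => ?_⟩
    rw [hΦ]
    simp only [φ, K, Pi.sub_apply, if_neg ((hes i).1 hi), hYf x hxV hxY, sub_self]
  · rintro y ⟨⟨hyT, hyV⟩, hy⟩
    refine ⟨ψ y, ⟨hyV, ?_⟩, hφψ y⟩
    have h1 : ψ y = f (restr s fun j => y (e j)) := by
      funext j
      by_cases hj : j ∈ s
      · have h2 := congrFun (hfY _ hyT).2 ⟨j, hj⟩
        simp only [restr] at h2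
        simp only [ψ, K, Pi.add_apply, if_pos hj, add_zero]
        exact h2.symm
      · have h2 : y (e j) = 0 := hy (e j) ((hes _).2 (by simpa using hj))
        simp only [ψ, K, Pi.add_apply, if_neg hj, h2, zero_add]
    rw [h1]
    exact (hfY _ hyT).1

end Charts

/-! ### The stratification -/

section Stratification

variable {ℓ : ℕ}

/-- Regularity with respect to some `d` of the coordinates. -/
def IsRegularOfDim (r d : ℕ) (X : (Fin ℓ → ℝ) → Prop) (p : Fin ℓ → ℝ) : Prop :=
  ∃ s ∈ Finset.univ.filter fun s : Finset (Fin ℓ) => s.card = d, IsRegularPt r s X p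

/-- What is left of `X` after the regular points of dimensions `ℓ, ℓ - 1, …, ℓ - m + 1` have
successively been removed. -/
def remainder (r : ℕ) (X : (Fin ℓ → ℝ) → Prop) : ℕ → (Fin ℓ → ℝ) → Prop
  | 0 => X
  | m + 1 => fun x => remainder r X m x ∧ ¬ IsRegularOfDim r (ℓ - m) (remainder r X m) x

/-- The stratum of dimension `d`: the regular points of dimension `d` of what is left after those of
higher dimension have been removed. -/
def stratum (r : ℕ) (X : (Fin ℓ → ℝ) → Prop) (d : ℕ) : (Fin ℓ → ℝ) → Prop :=
  IsRegularOfDim r d (remainder r X (ℓ - d))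

theorem isEmbeddedSubmanifold_isRegularOfDim (r : ℕ) {d : ℕ} (hd : d ≤ ℓ)
    (X : (Fin ℓ → ℝ) → Prop) : IsEmbeddedSubmanifold r d {x | IsRegularOfDim r d X x} := by
  refine isEmbeddedSubmanifold_of_graph hd fun p hp => ?_
  obtain ⟨s, hs, hps⟩ := hp
  obtain ⟨V, W, f, hVo, hWo, hpV, hVW, hVr, hfW, hXf, hT⟩ := hps.exists_graph
  refine ⟨s, V, W, f, (Finset.mem_filter.1 hs).2, hVo, hWo, hpV, hVW, fun u hu => ?_,
    fun x hxV hx => ?_, fun j u hu => ?_⟩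
  · obtain ⟨h1, h2, h3⟩ := hfW u hu
    exact ⟨⟨s, hs, hVr _ h1 h2⟩, h3⟩
  · obtain ⟨t, -, hxt⟩ := hx
    exact hXf x hxV hxt.1
  · exact ((hT j).contDiffAt hWo hu).contDiffWithinAt

theorem IsRegularPt.card_le_omDim {r : ℕ} {s : Finset (Fin ℓ)} {X : (Fin ℓ → ℝ) → Prop}
    {Y : Set (Fin ℓ → ℝ)} {p : Fin ℓ → ℝ} (h : IsRegularPt r s X p) (hXY : ∀ x, X x → x ∈ Y) :
    (s.card : WithBot ℕ) ≤ omDim Y := by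
  classical
  obtain ⟨V, W, f, -, hWo, hpV, hVW, -, hfW, -⟩ := h.exists_graph
  refine Finset.le_sup (f := fun s : Finset (Fin ℓ) => (s.card : WithBot ℕ))
    (Finset.mem_filter.2 ⟨Finset.mem_univ s, ?_⟩)
  refine ⟨restr s p, interior_maximal (fun u hu => ?_) hWo (hVW p hpV)⟩
  exact ⟨f u, hXY _ (hfW u hu).2.1, (hfW u hu).2.2⟩

theorem remainder_imp {r : ℕ} {X : (Fin ℓ → ℝ) → Prop} {m : ℕ} {x : Fin ℓ → ℝ}
    (h : remainder r X m x) : X x := by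
  induction m with
  | zero => exact h
  | succ m ih => exact ih h.1

theorem remainder_antitone {r : ℕ} {X : (Fin ℓ → ℝ) → Prop} {m n : ℕ} (hmn : m ≤ n)
    {x : Fin ℓ → ℝ} (h : remainder r X n x) : remainder r X m x := by
  induction hmn with
  | refl => exact h
  | step _ ih => exact ih h.1

variable {S : OMinimalExpansion} {Ω : FDFiltration S} {P : Type} {sc : Scale P}

theorem Sharp.isRegularOfDim (hΩ : IsPresharp Ω) {A : ∀ _ : P, (Fin ℓ → ℝ) → Prop}
    (hA : Sharp Ω sc A) (d : ℕ) : Sharp Ω sc fun p x => IsRegularOfDim (sc.r p) d (A p) x :=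
  Sharp.exists_finset hΩ (.const _) _ fun s _ => hA.isRegularPt hΩ s

theorem Sharp.remainder (hΩ : IsPresharp Ω) {A : ∀ _ : P, (Fin ℓ → ℝ) → Prop}
    (hA : Sharp Ω sc A) (m : ℕ) : Sharp Ω sc fun p x => remainder (sc.r p) (A p) m x := by
  induction m with
  | zero => exact hA
  | succ m ih => exact ih.and hΩ ((ih.isRegularOfDim hΩ (ℓ - m)).not hΩ)

/-- For a single set there is nothing to be uniform about. -/
theorem Sharp.changeScale {ι : Unit → Type} [∀ p, Fintype (ι p)] {A : ∀ p, (ι p → ℝ) → Prop}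
    {sc sc' : Scale Unit} (hA : Sharp Ω sc A) : Sharp Ω sc' A := by
  obtain ⟨c, q, h⟩ := hA
  exact ⟨fun _ _ => c (sc.F ()) (sc.r ()), MvPolynomial.C (sc.val q ()), fun p => by
    simpa [Scale.val] using h ()⟩

theorem isDef_remainder (hΩ : IsPresharp Ω) (r : ℕ) {X : (Fin ℓ → ℝ) → Prop} (hX : IsDef Ω X)
    (m : ℕ) : IsDef Ω (SharplyOMinimal.remainder r X m) :=
  ((hX.changeScale (sc' := ⟨fun _ => 0, fun _ => 0, fun _ => r⟩)).remainder hΩ m).changeScale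

/-- Each step lowers the dimension. -/
theorem card_add_le_of_interior_remainder (hΩ : IsPresharp Ω) (r : ℕ) {X : (Fin ℓ → ℝ) → Prop}
    (hX : IsDef Ω X) (m : ℕ) (s : Finset (Fin ℓ))
    (hs : (interior (restr s '' {x | remainder r X m x})).Nonempty) : s.card + m ≤ ℓ := by
  induction m generalizing s with
  | zero => simpa using s.card_le_univ
  | succ m ih =>
    have hsub : {x | remainder r X (m + 1) x} ⊆ {x | remainder r X m x} := fun x hx => hx.1
    have h1 := ih s (hs.mono (interior_mono (image_mono hsub)))
    by_contra hcon
    have hcard : s.card = ℓ - m := by omega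
    obtain ⟨x, hx, hreg⟩ := exists_isRegularPt hΩ r (isDef_remainder hΩ r hX m)
      (isDef_remainder hΩ r hX (m + 1)) (fun x hx => hx.1) (s := s)
      (fun t ht => by have := ih t ht; omega) hs
    exact hx.2 ⟨s, Finset.mem_filter.2 ⟨Finset.mem_univ _, hcard⟩, hreg⟩

theorem not_remainder_succ (hΩ : IsPresharp Ω) (r : ℕ) {X : (Fin ℓ → ℝ) → Prop}
    (hX : IsDef Ω X) (x : Fin ℓ → ℝ) : ¬ remainder r X (ℓ + 1) x := by
  intro hx
  have h1 : restr ∅ '' {x | remainder r X (ℓ + 1) x} = univ :=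
    eq_univ_of_forall fun u => ⟨x, hx, Subsingleton.elim _ _⟩
  have := card_add_le_of_interior_remainder hΩ r hX (ℓ + 1) ∅
    (by rw [h1, interior_univ]; exact univ_nonempty)
  omega

theorem exists_stratum (hΩ : IsPresharp Ω) (r : ℕ) {X : (Fin ℓ → ℝ) → Prop} (hX : IsDef Ω X)
    {x : Fin ℓ → ℝ} (hx : X x) : ∃ d ≤ ℓ, stratum r X d x := by
  by_contra! hcon
  suffices h : ∀ m ≤ ℓ + 1, remainder r X m x from
    not_remainder_succ hΩ r hX x (h _ le_rfl)
  intro m hm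
  induction m with
  | zero => exact hx
  | succ m ih =>
    refine ⟨ih (by omega), fun hreg => hcon (ℓ - m) (by omega) ?_⟩
    have : ℓ - (ℓ - m) = m := by omega
    rw [stratum, this]
    exact hreg

theorem stratum_imp {r : ℕ} {X : (Fin ℓ → ℝ) → Prop} {d : ℕ} {x : Fin ℓ → ℝ}
    (h : stratum r X d x) : X x := by
  obtain ⟨s, -, hs⟩ := h
  exact remainder_imp hs.1

theorem stratum_disjoint {r : ℕ} {X : (Fin ℓ → ℝ) → Prop} {d d' : ℕ} (hd : d < d') (hd' : d' ≤ ℓ)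
    {x : Fin ℓ → ℝ} (h : stratum r X d x) (h' : stratum r X d' x) : False := by
  obtain ⟨s, -, hs⟩ := h
  have h1 : remainder r X (ℓ - d' + 1) x := remainder_antitone (by omega) hs.1
  refine h1.2 ?_
  rw [show ℓ - (ℓ - d') = d' by omega]
  exact h'

theorem le_omDim_of_stratum {r : ℕ} {X : Set (Fin ℓ → ℝ)} {d : ℕ} {x : Fin ℓ → ℝ}
    (h : stratum r (fun x => x ∈ X) d x) : (d : WithBot ℕ) ≤ omDim X := by
  obtain ⟨s, hsd, hs⟩ := h
  rw [← (Finset.mem_filter.1 hsd).2]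
  exact hs.card_le_omDim fun _ => remainder_imp

theorem omDim_le (X : Set (Fin ℓ → ℝ)) : omDim X ≤ (ℓ : WithBot ℕ) := by
  classical
  refine Finset.sup_le fun s _ => ?_
  have : s.card ≤ ℓ := by simpa using s.card_le_univ
  exact_mod_cast this

variable (Ω) in
/-- A set of the filtration with its format, its degree and the order of smoothness required. -/
abbrev SmoothnessProblem (ℓ : ℕ) : Type :=
  {t : (ℕ × ℕ × ℕ) × Set (Fin ℓ → ℝ) // t.2 ∈ Ω.sets t.1.1 t.1.2.1 ℓ}

/-- The strata have format bounded in terms of the format and the order of smoothness, and degree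
polynomial in the degree and the order of smoothness. -/
theorem exists_stratum_bound (hΩ : IsPresharp Ω) (ℓ d : ℕ) :
    ∃ (c : ℕ → ℕ → ℕ) (q : MvPolynomial (Fin 2) ℕ), ∀ r F D, ∀ X ∈ Ω.sets F D ℓ,
      {x | stratum r (fun x => x ∈ X) d x} ∈ Ω.sets (c F r) (MvPolynomial.eval ![D, r] q) ℓ := by
  let sc : Scale (SmoothnessProblem Ω ℓ) :=
    ⟨fun t => t.1.1.1, fun t => t.1.1.2.1, fun t => t.1.1.2.2⟩
  have hA : Sharp Ω sc fun (t : SmoothnessProblem Ω ℓ) (x : Fin ℓ → ℝ) => x ∈ t.1.2 :=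
    Sharp.of_mem_sets_fin hΩ (c := fun F _ => F) (q := MvPolynomial.X 0) fun t => by
      simpa [Scale.val, sc] using t.2
  obtain ⟨c, q, h⟩ := Sharp.mem_sets_fin hΩ ((hA.remainder hΩ (ℓ - d)).isRegularOfDim hΩ d)
  exact ⟨c, q, fun r F D X hX => h ⟨((F, D, r), X), hX⟩⟩

end Stratification

end SharplyOMinimal

theorem mainTheorem7 (S : SharplyOMinimal.OMinimalExpansion)
    (Ω : SharplyOMinimal.FDFiltration S) (hΩ : SharplyOMinimal.IsPresharp Ω) :
    ∃ (C : ℕ → ℕ → ℕ) (P : ℕ → MvPolynomial (Fin 2) ℕ),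
      ∀ r : ℕ, 1 ≤ r → ∀ (F D ℓ : ℕ), ∀ X ∈ Ω.sets F D ℓ,
        ∃ Y : ℕ → Set (Fin ℓ → ℝ),
          X = (⋃ (i : ℕ) (_ : (i : WithBot ℕ) ≤ SharplyOMinimal.omDim X), Y i) ∧
          (∀ i j : ℕ, (i : WithBot ℕ) ≤ SharplyOMinimal.omDim X →
            (j : WithBot ℕ) ≤ SharplyOMinimal.omDim X → i ≠ j → Disjoint (Y i) (Y j)) ∧
          ∀ i : ℕ, (i : WithBot ℕ) ≤ SharplyOMinimal.omDim X →
            Y i ∈ Ω.sets (C F r) (MvPolynomial.eval ![D, r] (P F)) ℓ ∧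
            ∃ k : ℕ, SharplyOMinimal.IsEmbeddedSubmanifold r k (Y i) := by
  open SharplyOMinimal in
  choose c q h using fun ℓ d => exists_stratum_bound hΩ ℓ d
  refine ⟨fun F r => ∑ ℓ ∈ Finset.range (F + 1), ∑ d ∈ Finset.range (ℓ + 1), c ℓ d F r,
    fun F => ∑ ℓ ∈ Finset.range (F + 1), ∑ d ∈ Finset.range (ℓ + 1), q ℓ d,
    fun r _ F D ℓ X hX => ⟨fun d => {x | stratum r (fun x => x ∈ X) d x}, ?_, ?_, ?_⟩⟩
  · have hXd := isDef_of_mem hΩ (Ω.definable _ _ _ hX)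
    ext x
    simp only [mem_iUnion, exists_prop]
    constructor
    · intro hx
      obtain ⟨d, -, hd⟩ := exists_stratum hΩ r hXd hx
      exact ⟨d, le_omDim_of_stratum hd, hd⟩
    · rintro ⟨d, -, hd⟩
      exact stratum_imp hd
  · intro i j hi hj hij
    have hi' : i ≤ ℓ := by exact_mod_cast hi.trans (omDim_le X)
    have hj' : j ≤ ℓ := by exact_mod_cast hj.trans (omDim_le X)
    rw [Set.disjoint_left]
    intro x hx hx'
    rcases lt_or_gt_of_ne hij with hlt | hlt
    · exact stratum_disjoint hlt hj' hx hx'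
    · exact stratum_disjoint hlt hi' hx' hx
  · intro i hi
    have hi' : i ≤ ℓ := by exact_mod_cast hi.trans (omDim_le X)
    have hℓ : ℓ ≤ F := hΩ.dim_le_format _ _ _ _ hX
    refine ⟨Ω.sets_mono ?_ ?_ (h ℓ i r F D X hX), i, isEmbeddedSubmanifold_isRegularOfDim r hi' _⟩
    · exact (Finset.single_le_sum (f := fun d => c ℓ d F r) (fun _ _ => Nat.zero_le _)
        (Finset.mem_range.2 (by omega : i < ℓ + 1))).trans
        (Finset.single_le_sum (f := fun ℓ => ∑ d ∈ Finset.range (ℓ + 1), c ℓ d F r)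
          (fun _ _ => Nat.zero_le _) (Finset.mem_range.2 (by omega : ℓ < F + 1)))
    · simp only [map_sum]
      exact (Finset.single_le_sum (f := fun d => MvPolynomial.eval ![D, r] (q ℓ d))
        (fun _ _ => Nat.zero_le _) (Finset.mem_range.2 (by omega : i < ℓ + 1))).trans
        (Finset.single_le_sum (f := fun ℓ => ∑ d ∈ Finset.range (ℓ + 1),
          MvPolynomial.eval ![D, r] (q ℓ d))
          (fun _ _ => Nat.zero_le _) (Finset.mem_range.2 (by omega : ℓ < F + 1)))
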